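/- Let $T$ be the infinite rooted binary tree whose vertices are the finite words over $\{0,1\}$, each word $\sigma$ being joined to its children $\sigma 0$ and $\sigma 1$. The Grigorchuk group is the subgroup $\Gamma=\langle a,b,c,d\rangle$ of $\mathrm{Aut}(T)$ generated by the automorphisms that fix the empty word and are given recursively, for every $\sigma\in\{0,1\}^*$, by \[ a(0\sigma)=1\sigma,\quad a(1\sigma)=0\sigma,\qquad b(0\sigma)=0\,a(\sigma),\quad b(1\sigma)=1\,c(\sigma), \] \[ c(0\sigma)=0\,a(\sigma),\quad c(1\sigma)=1\,d(\sigma),\qquad d(0\sigma)=0\sigma,\quad d(1\sigma)=1\,b(\sigma). \] For groups $A$ and $B$, the restricted wreath product is $A\wr B=\bigl(\bigoplus_{B}A\bigr)\rtimes B$, where $\bigoplus_B A$ is the group of finitely supported functions $B\to A$ and $B$ acts on it by left translation, $(b\cdot f)(x)=f(b^{-1}x)$. The pro-$2$ topology on a group $G$ is the topology with base the cosets $gN$, where $g\in G$ and $N\unlhd G$ is a normal subgroup such that $G/N$ is a finite $2$-group. A group is $2$-conjugacy separable if each of its conjugacy classes is closed in its pro-$2$ topology. A group $G$ is $2$-hereditarily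 conjugacy separable if $G$ is $2$-conjugacy separable and every subgroup of $G$ that is open in the pro-$2$ topology on $G$ is $2$-conjugacy separable (with respect to its own pro-$2$ topology). Then, for every integer $m\ge 0$, the group $\mathbb{Z}^m\wr \Gamma$ is $2$-hereditarily conjugacy separable. -/

import Mathlib

open scoped Topology

/-! ### The pro-`p` topology and conjugacy separability -/

/-- `N` is a co-`p` subgroup of `G`: it is normal and `G ⧸ N` is a finite `p`-group. -/
def IsCoP (p : ℕ) {G : Type*} [Group G] (N : Subgroup G) : Prop :=
  ∃ _ : N.Normal, Finite (G ⧸ N) ∧ IsPGroup p (G ⧸ N)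

/-- The pro-`p` topology on a group `G`: the topology with base the cosets `g N`, where
`N` is a co-`p` subgroup of `G`. -/
@[reducible]
def proPTopology (p : ℕ) (G : Type*) [Group G] : TopologicalSpace G :=
  TopologicalSpace.generateFrom
    {U | ∃ (g : G) (N : Subgroup G), IsCoP p N ∧ U = {x | g⁻¹ * x ∈ N}}

/-- `G` is `p`-conjugacy separable: every conjugacy class is closed in the pro-`p` topology. -/
def IsPConjSeparable (p : ℕ) (G : Type*) [Group G] : Prop :=
  ∀ g : G, IsClosed[proPTopology p G] {x : G | IsConj g x}

/-- `G` is `p`-hereditarily conjugacy separable: `G`, and every subgroup of `G` which is open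
in the pro-`p` topology of `G`, is `p`-conjugacy separable. -/
def IsPHereditarilyConjSeparable (p : ℕ) (G : Type*) [Group G] : Prop :=
  IsPConjSeparable p G ∧
    ∀ H : Subgroup G, IsOpen[proPTopology p G] (H : Set G) → IsPConjSeparable p H

/-! ### Restricted wreath products -/

/-- The restricted wreath product of `A` and `B`, as the subgroup of the unrestricted regular
wreath product that consists of the pairs `(f, b)` with `f : B → A` of finite support. -/
def restrictedWreathProduct (A B : Type*) [Group A] [Group B] : Subgroup (A ≀ᵣ B) where
  carrier := {x | (Function.mulSupport x.left).Finite}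
  one_mem' := by simp
  mul_mem' := by
    intro x y hx hy
    have hy' : (Function.mulSupport fun z ↦ y.left (x.right⁻¹ * z)).Finite :=
      hy.preimage (mul_right_injective x.right⁻¹).injOn
    exact (hx.union hy').subset (Function.mulSupport_mul _ _)
  inv_mem' := by
    intro x hx
    have h : (Function.mulSupport fun z ↦ x.left (x.right * z)).Finite :=
      hx.preimage (mul_right_injective x.right).injOn
    refine h.subset ?_
    intro z hz
    simpa using hz

/-! ### The Grigorchuk group -/

/-- The infinite binary rooted tree: the vertices are the finite binary sequences
(`false` is the letter `0` and `true` is the letter `1`), and `σ` is joined to its two children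
`σ0` and `σ1`. -/
def binaryTree : SimpleGraph (List Bool) where
  Adj σ τ := (∃ x, τ = σ ++ [x]) ∨ (∃ x, σ = τ ++ [x])
  symm := ⟨fun _ _ h ↦ h.symm⟩
  loopless := ⟨fun σ h ↦ by
    rcases h with ⟨x, h⟩ | ⟨x, h⟩ <;> simpa using congrArg List.length h⟩

namespace Grigorchuk

/-- The action of the generator `a` on binary sequences. -/
def actA : List Bool → List Bool
  | [] => []
  | false :: σ => true :: σ
  | true :: σ => false :: σ

mutual

/-- The action of the generator `b` on binary sequences. -/
def actB : List Bool → List Bool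
  | [] => []
  | false :: σ => false :: actA σ
  | true :: σ => true :: actC σ

/-- The action of the generator `c` on binary sequences. -/
def actC : List Bool → List Bool
  | [] => []
  | false :: σ => false :: actA σ
  | true :: σ => true :: actD σ

/-- The action of the generator `d` on binary sequences. -/
def actD : List Bool → List Bool
  | [] => []
  | false :: σ => false :: σ
  | true :: σ => true :: actB σ

end

theorem actA_actA (σ : List Bool) : actA (actA σ) = σ := by
  rcases σ with _ | ⟨_ | _, σ⟩ <;> rfl

theorem actBCD_invol (σ : List Bool) :
    actB (actB σ) = σ ∧ actC (actC σ) = σ ∧ actD (actD σ) = σ := by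
  induction σ with
  | nil => simp [actB, actC, actD]
  | cons x σ ih => cases x <;> simp [actB, actC, actD, actA_actA, ih]

theorem actA_child (σ : List Bool) (x : Bool) : ∃ y, actA (σ ++ [x]) = actA σ ++ [y] := by
  rcases σ with _ | ⟨_ | _, σ⟩
  · cases x <;> simp [actA]
  · exact ⟨x, rfl⟩
  · exact ⟨x, rfl⟩

theorem actBCD_child (σ : List Bool) (x : Bool) :
    (∃ y, actB (σ ++ [x]) = actB σ ++ [y]) ∧ (∃ y, actC (σ ++ [x]) = actC σ ++ [y]) ∧
      (∃ y, actD (σ ++ [x]) = actD σ ++ [y]) := by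
  induction σ with
  | nil => cases x <;> simp [actA, actB, actC, actD]
  | cons z σ ih =>
    have hA := actA_child σ x
    cases z <;> simp [actB, actC, actD, hA, ih]

/-- An involution of the binary sequences that maps children of `σ` to children of the image of
`σ`, as an automorphism of the tree. -/
def autOfInvolution (f : List Bool → List Bool) (hf : ∀ σ, f (f σ) = σ)
    (hc : ∀ σ x, ∃ y, f (σ ++ [x]) = f σ ++ [y]) : binaryTree ≃g binaryTree where
  toFun := f
  invFun := f
  left_inv := hf
  right_inv := hf
  map_rel_iff' := by
    have key : ∀ σ τ, binaryTree.Adj σ τ → binaryTree.Adj (f σ) (f τ) := by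
      rintro σ τ (⟨x, rfl⟩ | ⟨x, rfl⟩)
      · exact Or.inl (hc σ x)
      · exact Or.inr (hc τ x)
    intro σ τ
    refine ⟨fun h ↦ ?_, key σ τ⟩
    have := key _ _ h
    simpa only [Equiv.coe_fn_mk, hf] using this

/-- The generator `a` of the Grigorchuk group. -/
def a : binaryTree ≃g binaryTree := autOfInvolution actA actA_actA actA_child

/-- The generator `b` of the Grigorchuk group. -/
def b : binaryTree ≃g binaryTree :=
  autOfInvolution actB (fun σ ↦ (actBCD_invol σ).1) (fun σ x ↦ (actBCD_child σ x).1)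

/-- The generator `c` of the Grigorchuk group. -/
def c : binaryTree ≃g binaryTree :=
  autOfInvolution actC (fun σ ↦ (actBCD_invol σ).2.1) (fun σ x ↦ (actBCD_child σ x).2.1)

/-- The generator `d` of the Grigorchuk group. -/
def d : binaryTree ≃g binaryTree :=
  autOfInvolution actD (fun σ ↦ (actBCD_invol σ).2.2) (fun σ x ↦ (actBCD_child σ x).2.2)

end Grigorchuk

/-- The Grigorchuk group: the subgroup of the automorphism group of the binary rooted tree
generated by `a`, `b`, `c`, `d`. -/
def grigorchukGroup : Subgroup (binaryTree ≃g binaryTree) :=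
  Subgroup.closure {Grigorchuk.a, Grigorchuk.b, Grigorchuk.c, Grigorchuk.d}

-- Both halves of the argument prove a statement stronger than conjugacy separability,
-- `HasClosedConjOrbits`, about orbits under conjugation by a co-`p` subgroup `N`. It yields
-- heredity at once: an open subgroup contains such an `N`, so its conjugacy classes are finite
-- unions of `N`-orbits.
--
-- For the Grigorchuk group, every normal subgroup of finite index contains some `Kn n`, the product
-- of copies of the branching subgroup `K` at the vertices of level `n` (`exists_Kn_le`). It
-- therefore suffices to detect conjugacy by elements of a prescribed coset of `Kn n` in the level
-- quotients. Conjugacy of two elements reduces to conjugacy of their sections, or of products of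
-- their two sections when they swap the subtrees, and branching over `K` glues the conjugators
-- found below into one (`conjDetected_of_sec`, `conjDetected_of_sec_mul_sec`). A weight on words
-- drops under this reduction, which leaves trivial elements and the generators `b`, `c`, `d`
-- (`conjDetected_K`). The same descent shows that the group is torsion.
--
-- For the wreath product, write elements as pairs in ℤ^m[B] ⋊ B. The pair `(h, z)` conjugates `(f,
-- γ)` to `(f', γ)` exactly when `z` centralises `γ` and f' - z f = (1 - γ) h. Since `γ` has finite
-- order, the group ring is free over the cyclic group it generates, so the kernel of `1 - γ` is the
-- image of the trace and conversely. If the trace of `f` vanishes, `z = 1` works; otherwise its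
-- support leaves finitely many candidates for `z` (`exists_commuting`). Finally, `1 - γ` has closed
-- image on congruence subgroups (`exists_eq_one_sub_mul_of_red`), which produces `h`.

namespace Grigorchuk

/-- The Grigorchuk group as a type. -/
abbrev Grig : Type := ↥grigorchukGroup

/-- The action of the Grigorchuk group on binary sequences. -/
def act (g : Grig) (σ : List Bool) : List Bool := (g : binaryTree ≃g binaryTree) σ

theorem act_mul (g h : Grig) (σ : List Bool) : act (g * h) σ = act g (act h σ) := rfl

theorem act_one (σ : List Bool) : act 1 σ = σ := rfl

theorem act_ext {g h : Grig} (H : ∀ σ, act g σ = act h σ) : g = h :=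
  Subtype.ext (RelIso.ext H)

/-- The generator `a`, as an element of the group. -/
def gA : Grig := ⟨a, Subgroup.subset_closure (by simp)⟩
/-- The generator `b`, as an element of the group. -/
def gB : Grig := ⟨b, Subgroup.subset_closure (by simp)⟩
/-- The generator `c`, as an element of the group. -/
def gC : Grig := ⟨c, Subgroup.subset_closure (by simp)⟩
/-- The generator `d`, as an element of the group. -/
def gD : Grig := ⟨d, Subgroup.subset_closure (by simp)⟩

-- Wreath recursion: the swap at the root and the sections

theorem grig_induction {P : Grig → Prop} (one : P 1) (hA : ∀ g, P g → P (gA * g))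
    (hB : ∀ g, P g → P (gB * g)) (hC : ∀ g, P g → P (gC * g)) (hD : ∀ g, P g → P (gD * g))
    (g : Grig) : P g := by
  obtain ⟨g, hg⟩ := g
  have inv : ∀ x ∈ ({a, b, c, d} : Set (binaryTree ≃g binaryTree)), x⁻¹ = x := by
    rintro x (rfl | rfl | rfl | rfl) <;> rfl
  have key : ∀ x (hx : x ∈ ({a, b, c, d} : Set (binaryTree ≃g binaryTree))) (y) (hy : y ∈ grigorchukGroup),
      P ⟨y, hy⟩ → P ⟨x * y, mul_mem (Subgroup.subset_closure hx) hy⟩ := by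
    rintro x (rfl | rfl | rfl | rfl) y hy h
    exacts [hA _ h, hB _ h, hC _ h, hD _ h]
  induction hg using Subgroup.closure_induction_left with
  | one => exact one
  | mul_left x hx y hy ih => exact key x hx y hy ih
  | inv_mul_cancel x hx y hy ih =>
    have h := key x hx y hy ih
    have e : (⟨x⁻¹ * y, mul_mem (inv_mem (Subgroup.subset_closure hx)) hy⟩ : Grig) =
        ⟨x * y, mul_mem (Subgroup.subset_closure hx) hy⟩ :=
      Subtype.ext (congrArg (· * y) (inv x hx))
    exact e ▸ h

theorem exists_sec (g : Grig) : act g [] = [] ∧ ∃ (e : Bool) (s : Bool → Grig),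
    ∀ x σ, act g (x :: σ) = (x ^^ e) :: act (s x) σ := by
  have key : ∀ (g h : Grig), (act g [] = [] ∧ ∃ (e : Bool) (s : Bool → Grig),
    ∀ x σ, act g (x :: σ) = (x ^^ e) :: act (s x) σ) → (act h [] = [] ∧ ∃ (e : Bool) (s : Bool → Grig),
    ∀ x σ, act h (x :: σ) = (x ^^ e) :: act (s x) σ) → (act (g * h) [] = [] ∧ ∃ (e : Bool) (s : Bool → Grig),
    ∀ x σ, act (g * h) (x :: σ) = (x ^^ e) :: act (s x) σ) := by
    rintro g h ⟨g0, e, s, hg⟩ ⟨h0, e', s', hh⟩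
    refine ⟨by rw [act_mul, h0, g0], e' ^^ e, fun x ↦ s (x ^^ e') * s' x, fun x σ ↦ ?_⟩
    rw [act_mul, hh, hg, act_mul, Bool.xor_assoc]
  induction g using grig_induction with
  | one => exact ⟨rfl, false, fun _ ↦ 1, fun x σ ↦ by simp [act_one]⟩
  | hA g ih =>
    refine key _ _ ⟨rfl, true, fun _ ↦ 1, fun x σ ↦ ?_⟩ ih
    cases x <;> rfl
  | hB g ih =>
    refine key _ _ ⟨by simp [act, gB, b, autOfInvolution, actB], false, fun x ↦ bif x then gC else gA, fun x σ ↦ ?_⟩ ih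
    cases x <;> simp [act, gB, b, c, a, gA, gC, autOfInvolution, actB]
  | hC g ih =>
    refine key _ _ ⟨by simp [act, gC, c, autOfInvolution, actC], false, fun x ↦ bif x then gD else gA, fun x σ ↦ ?_⟩ ih
    cases x <;> simp [act, d, c, a, gA, gC, gD, autOfInvolution, actC]
  | hD g ih =>
    refine key _ _ ⟨by simp [act, gD, d, autOfInvolution, actD], false, fun x ↦ bif x then gB else 1, fun x σ ↦ ?_⟩ ih
    cases x <;> simp [act, d, b, gB, gD, autOfInvolution, actD]

theorem act_nil (g : Grig) : act g [] = [] := (exists_sec g).1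

/-- Whether `g` swaps the two subtrees below the root. -/
noncomputable def swp (g : Grig) : Bool := (exists_sec g).2.choose

/-- The section of `g` at the vertex `x` of the first level. -/
noncomputable def sec (x : Bool) (g : Grig) : Grig := (exists_sec g).2.choose_spec.choose x

theorem act_cons (g : Grig) (x : Bool) (σ : List Bool) :
    act g (x :: σ) = (x ^^ swp g) :: act (sec x g) σ :=
  (exists_sec g).2.choose_spec.choose_spec x σ

theorem sec_unique {g : Grig} {e : Bool} {s : Bool → Grig}
    (H : ∀ x σ, act g (x :: σ) = (x ^^ e) :: act (s x) σ) : swp g = e ∧ ∀ x, sec x g = s x := by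
  have h1 : ∀ x σ, (x ^^ swp g) = (x ^^ e) ∧ act (sec x g) σ = act (s x) σ := fun x σ ↦ by
    have := H x σ
    rw [act_cons] at this
    exact List.cons_eq_cons.1 this
  exact ⟨by simpa using (h1 false []).1, fun x ↦ act_ext fun σ ↦ (h1 x σ).2⟩

theorem sec_ext {g h : Grig} (h1 : swp g = swp h) (h2 : ∀ x, sec x g = sec x h) : g = h := by
  refine act_ext fun σ ↦ ?_
  cases σ with
  | nil => rw [act_nil, act_nil]
  | cons x σ => rw [act_cons, act_cons, h1, h2]

theorem swp_sec_mul (g h : Grig) : swp (g * h) = (swp g ^^ swp h) ∧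
    ∀ x, sec x (g * h) = sec (x ^^ swp h) g * sec x h := by
  refine sec_unique fun x σ ↦ ?_
  rw [act_mul, act_cons, act_cons, act_mul, Bool.xor_assoc, Bool.xor_comm (swp h)]

@[simp] theorem swp_mul (g h : Grig) : swp (g * h) = (swp g ^^ swp h) := (swp_sec_mul g h).1

@[simp] theorem sec_mul (x : Bool) (g h : Grig) : sec x (g * h) = sec (x ^^ swp h) g * sec x h :=
  (swp_sec_mul g h).2 x

theorem swp_sec_one : swp 1 = false ∧ ∀ x, sec x 1 = 1 :=
  sec_unique (g := 1) (s := fun _ ↦ 1) fun x σ ↦ by simp [act_one]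

@[simp] theorem swp_one : swp 1 = false := swp_sec_one.1
@[simp] theorem sec_one (x : Bool) : sec x 1 = 1 := swp_sec_one.2 x

@[simp] theorem swp_inv (g : Grig) : swp g⁻¹ = swp g := by
  have := swp_mul g⁻¹ g
  rw [inv_mul_cancel, swp_one] at this
  revert this
  cases swp g⁻¹ <;> cases swp g <;> simp

@[simp] theorem sec_inv (x : Bool) (g : Grig) : sec x g⁻¹ = (sec (x ^^ swp g) g)⁻¹ := by
  have := sec_mul (x ^^ swp g) g⁻¹ g
  rw [inv_mul_cancel, sec_one, Bool.xor_assoc, Bool.xor_self, Bool.xor_false] at this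
  exact eq_inv_of_mul_eq_one_left this.symm

theorem swp_sec_gA : swp gA = true ∧ ∀ x, sec x gA = 1 :=
  sec_unique (s := fun _ ↦ 1) fun x σ ↦ by cases x <;> rfl

theorem swp_sec_gB : swp gB = false ∧ ∀ x, sec x gB = bif x then gC else gA :=
  sec_unique fun x σ ↦ by cases x <;> simp [act, gB, b, c, a, gA, gC, autOfInvolution, actB]

theorem swp_sec_gC : swp gC = false ∧ ∀ x, sec x gC = bif x then gD else gA :=
  sec_unique fun x σ ↦ by cases x <;> simp [act, d, c, a, gA, gC, gD, autOfInvolution, actC]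

theorem swp_sec_gD : swp gD = false ∧ ∀ x, sec x gD = bif x then gB else 1 :=
  sec_unique fun x σ ↦ by cases x <;> simp [act, d, b, gB, gD, autOfInvolution, actD]

@[simp] theorem swp_gA : swp gA = true := swp_sec_gA.1
@[simp] theorem swp_gB : swp gB = false := swp_sec_gB.1
@[simp] theorem swp_gC : swp gC = false := swp_sec_gC.1
@[simp] theorem swp_gD : swp gD = false := swp_sec_gD.1
@[simp] theorem sec_gA (x : Bool) : sec x gA = 1 := swp_sec_gA.2 x
@[simp] theorem sec_false_gB : sec false gB = gA := swp_sec_gB.2 false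
@[simp] theorem sec_true_gB : sec true gB = gC := swp_sec_gB.2 true
@[simp] theorem sec_false_gC : sec false gC = gA := swp_sec_gC.2 false
@[simp] theorem sec_true_gC : sec true gC = gD := swp_sec_gC.2 true
@[simp] theorem sec_false_gD : sec false gD = 1 := swp_sec_gD.2 false
@[simp] theorem sec_true_gD : sec true gD = gB := swp_sec_gD.2 true

/-! ### Relations between the generators -/

@[simp] theorem gA_mul_gA : gA * gA = 1 := act_ext fun σ ↦ actA_actA σ
@[simp] theorem gB_mul_gB : gB * gB = 1 := act_ext fun σ ↦ (actBCD_invol σ).1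
@[simp] theorem gC_mul_gC : gC * gC = 1 := act_ext fun σ ↦ (actBCD_invol σ).2.1
@[simp] theorem gD_mul_gD : gD * gD = 1 := act_ext fun σ ↦ (actBCD_invol σ).2.2
@[simp] theorem gA_mul_gA_mul (g : Grig) : gA * (gA * g) = g := by rw [← mul_assoc]; simp
@[simp] theorem gB_mul_gB_mul (g : Grig) : gB * (gB * g) = g := by rw [← mul_assoc]; simp
@[simp] theorem gC_mul_gC_mul (g : Grig) : gC * (gC * g) = g := by rw [← mul_assoc]; simp
@[simp] theorem gD_mul_gD_mul (g : Grig) : gD * (gD * g) = g := by rw [← mul_assoc]; simp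
@[simp] theorem gA_inv : gA⁻¹ = gA := inv_eq_of_mul_eq_one_left gA_mul_gA
@[simp] theorem gB_inv : gB⁻¹ = gB := inv_eq_of_mul_eq_one_left gB_mul_gB
@[simp] theorem gC_inv : gC⁻¹ = gC := inv_eq_of_mul_eq_one_left gC_mul_gC
@[simp] theorem gD_inv : gD⁻¹ = gD := inv_eq_of_mul_eq_one_left gD_mul_gD

theorem actBCD_comp (σ : List Bool) : actB (actC σ) = actD σ ∧ actC (actD σ) = actB σ ∧
    actD (actB σ) = actC σ := by
  induction σ with
  | nil => simp [actB, actC, actD]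
  | cons x σ ih => cases x <;> simp [actB, actC, actD, actA_actA, ih]

@[simp] theorem gB_mul_gC : gB * gC = gD := act_ext fun σ ↦ (actBCD_comp σ).1
@[simp] theorem gC_mul_gD : gC * gD = gB := act_ext fun σ ↦ (actBCD_comp σ).2.1
@[simp] theorem gD_mul_gB : gD * gB = gC := act_ext fun σ ↦ (actBCD_comp σ).2.2
@[simp] theorem gC_mul_gB : gC * gB = gD := by
  rw [← gC_inv, ← gB_inv, ← mul_inv_rev, gB_mul_gC, gD_inv]
@[simp] theorem gD_mul_gC : gD * gC = gB := by
  rw [← gC_inv, ← gD_inv, ← mul_inv_rev, gC_mul_gD, gB_inv]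
@[simp] theorem gB_mul_gD : gB * gD = gC := by
  rw [← gB_inv, ← gD_inv, ← mul_inv_rev, gD_mul_gB, gC_inv]
@[simp] theorem gB_mul_gC_mul (g : Grig) : gB * (gC * g) = gD * g := by rw [← mul_assoc]; simp
@[simp] theorem gC_mul_gD_mul (g : Grig) : gC * (gD * g) = gB * g := by rw [← mul_assoc]; simp
@[simp] theorem gD_mul_gB_mul (g : Grig) : gD * (gB * g) = gC * g := by rw [← mul_assoc]; simp
@[simp] theorem gC_mul_gB_mul (g : Grig) : gC * (gB * g) = gD * g := by rw [← mul_assoc]; simp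
@[simp] theorem gD_mul_gC_mul (g : Grig) : gD * (gC * g) = gB * g := by rw [← mul_assoc]; simp
@[simp] theorem gB_mul_gD_mul (g : Grig) : gB * (gD * g) = gC * g := by rw [← mul_assoc]; simp

/-! ### Subgroups defined by sections, level stabilisers -/

/-- The elements that fix the first level and whose sections lie in `R`. -/
def below (R : Subgroup Grig) : Subgroup Grig where
  carrier := {g | swp g = false ∧ ∀ x, sec x g ∈ R}
  one_mem' := by simp [one_mem]
  mul_mem' := by
    rintro g h ⟨g1, g2⟩ ⟨h1, h2⟩
    exact ⟨by simp [g1, h1], fun x ↦ by simpa [h1] using mul_mem (g2 x) (h2 x)⟩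
  inv_mem' := by
    rintro g ⟨g1, g2⟩
    exact ⟨by simp [g1], fun x ↦ by simpa [g1] using g2 x⟩

theorem mem_below {R : Subgroup Grig} {g : Grig} :
    g ∈ below R ↔ swp g = false ∧ ∀ x, sec x g ∈ R := Iff.rfl

theorem inv_mul_mem_below {R : Subgroup Grig} {g h : Grig} :
    g⁻¹ * h ∈ below R ↔ swp g = swp h ∧ ∀ x, (sec x g)⁻¹ * sec x h ∈ R := by
  rw [mem_below]
  simp only [swp_mul, swp_inv, sec_mul, sec_inv]
  constructor
  · rintro ⟨h1, h2⟩
    have h1 : swp g = swp h := by revert h1; cases swp g <;> cases swp h <;> simp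
    exact ⟨h1, fun x ↦ by simpa [h1] using h2 x⟩
  · rintro ⟨h1, h2⟩
    exact ⟨by simp [h1], fun x ↦ by simpa [h1] using h2 x⟩

theorem below_mono {R S : Subgroup Grig} (h : R ≤ S) : below R ≤ below S :=
  fun _ hg ↦ ⟨hg.1, fun x ↦ h (hg.2 x)⟩

theorem sec_conj_of_swp_eq_false {g : Grig} (u : Grig) (hg : swp g = false) (x : Bool) :
    sec x (u * g * u⁻¹) = sec (x ^^ swp u) u * sec (x ^^ swp u) g * (sec (x ^^ swp u) u)⁻¹ := by
  simp [hg]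

theorem swp_conj (u g : Grig) : swp (u * g * u⁻¹) = swp g := by
  simp only [swp_mul, swp_inv]; cases swp u <;> cases swp g <;> rfl

instance below_normal (R : Subgroup Grig) [hR : R.Normal] : (below R).Normal where
  conj_mem g hg u := ⟨by rw [swp_conj, hg.1], fun x ↦ by
    rw [sec_conj_of_swp_eq_false u hg.1]
    exact hR.conj_mem _ (hg.2 _) _⟩

theorem finite_quotient_below (R : Subgroup Grig) [Finite (Grig ⧸ R)] : Finite (Grig ⧸ below R) := by
  let f : Grig ⧸ below R → Bool × (Bool → Grig ⧸ R) :=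
    Quotient.lift (fun g ↦ (swp g, fun x ↦ (sec x g : Grig ⧸ R))) (by
      intro g h H
      have H := inv_mul_mem_below.1 (QuotientGroup.leftRel_apply.1 H)
      ext x
      · exact H.1
      · exact QuotientGroup.eq.2 (H.2 _))
  refine Finite.of_injective f ?_
  rintro ⟨g⟩ ⟨h⟩ H
  refine QuotientGroup.eq.2 (inv_mul_mem_below.2 ⟨congrArg Prod.fst H, fun x ↦ ?_⟩)
  exact QuotientGroup.eq.1 (congrFun (congrArg Prod.snd H) x)

/-- The stabiliser of the level `n`. -/
def St (n : ℕ) : Subgroup Grig := below^[n] ⊤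

theorem St_succ (n : ℕ) : St (n + 1) = below (St n) := Function.iterate_succ_apply' _ _ _

theorem mem_St_zero (g : Grig) : g ∈ St 0 := Subgroup.mem_top g

theorem mem_St_succ {n : ℕ} {g : Grig} : g ∈ St (n + 1) ↔ swp g = false ∧ ∀ x, sec x g ∈ St n := by
  rw [St_succ, mem_below]

instance St_normal (n : ℕ) : (St n).Normal := by
  induction n with
  | zero => exact Subgroup.normal_top
  | succ n ih => rw [St_succ]; infer_instance

instance finite_quotient_St (n : ℕ) : Finite (Grig ⧸ St n) := by
  induction n with
  | zero => exact @Finite.of_subsingleton _ QuotientGroup.subsingleton_quotient_top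
  | succ n ih => rw [St_succ]; exact finite_quotient_below _

theorem St_antitone : Antitone St := by
  refine antitone_nat_of_succ_le fun n ↦ ?_
  induction n with
  | zero => exact fun g _ ↦ mem_St_zero g
  | succ n ih => rw [St_succ (n + 1)]; rw [St_succ n] at ih ⊢; exact below_mono ih

/-- A square never swaps at the root, so a further power is computed section by section and each
level costs one factor two. -/
theorem pow_mem_St (n : ℕ) : ∀ g : Grig, g ^ 2 ^ n ∈ St n := by
  have key : ∀ (h : Grig), swp h = false → ∀ m : ℕ, swp (h ^ m) = false ∧ ∀ x, sec x (h ^ m) = sec x h ^ m := by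
    intro h hh m
    induction m with
    | zero => simp
    | succ m ih => simp [pow_succ, ih, hh]
  induction n with
  | zero => exact fun g ↦ mem_St_zero _
  | succ n ih =>
    intro g
    rw [pow_succ', pow_mul, mem_St_succ]
    have := key (g ^ 2) (by simp [pow_two]) (2 ^ n)
    exact ⟨this.1, fun x ↦ by rw [this.2]; exact ih _⟩

theorem isCoP_St (n : ℕ) : IsCoP 2 (St n) := by
  refine ⟨St_normal n, finite_quotient_St n, ?_⟩
  rintro ⟨g⟩
  exact ⟨n, (QuotientGroup.eq_one_iff _).2 (pow_mem_St n g)⟩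

theorem eq_one_of_mem_St {g : Grig} (hg : ∀ n, g ∈ St n) : g = 1 := by
  have : ∀ σ : List Bool, ∀ g ∈ St σ.length, act g σ = σ := by
    intro σ
    induction σ with
    | nil => exact fun g _ ↦ act_nil g
    | cons x σ ih =>
      intro g hg
      rw [List.length_cons, mem_St_succ] at hg
      rw [act_cons, hg.1, ih _ (hg.2 x), Bool.xor_false]
  exact act_ext fun σ ↦ this σ g (hg _)

/-! ### Two homomorphisms to the group of order two -/

/-- The number modulo two of vertices of level one at which `g` swaps. -/
noncomputable def chi₁ (g : Grig) : Bool := swp (sec false g) ^^ swp (sec true g)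

/-- The number modulo two of vertices of level two at which `g` swaps. -/
noncomputable def chi₂ (g : Grig) : Bool := chi₁ (sec false g) ^^ chi₁ (sec true g)

theorem xor_xor_xor_comm : ∀ p q r s : Bool,
    ((p ^^ q) ^^ (r ^^ s)) = ((p ^^ r) ^^ (q ^^ s)) := by decide

theorem xor_xor_xor_comm' : ∀ p q r s : Bool,
    ((p ^^ q) ^^ (r ^^ s)) = ((r ^^ p) ^^ (q ^^ s)) := by decide

@[simp] theorem chi₁_mul (g h : Grig) : chi₁ (g * h) = (chi₁ g ^^ chi₁ h) := by
  simp only [chi₁, sec_mul, swp_mul]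
  cases swp h
  · exact xor_xor_xor_comm _ _ _ _
  · exact xor_xor_xor_comm' _ _ _ _

@[simp] theorem chi₂_mul (g h : Grig) : chi₂ (g * h) = (chi₂ g ^^ chi₂ h) := by
  simp only [chi₂, sec_mul, chi₁_mul]
  cases swp h
  · exact xor_xor_xor_comm _ _ _ _
  · exact xor_xor_xor_comm' _ _ _ _

@[simp] theorem chi₁_one : chi₁ 1 = false := by simp [chi₁]
@[simp] theorem chi₂_one : chi₂ 1 = false := by simp [chi₂]

@[simp] theorem chi₁_inv (g : Grig) : chi₁ g⁻¹ = chi₁ g := by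
  have := chi₁_mul g⁻¹ g
  rw [inv_mul_cancel, chi₁_one] at this
  revert this; cases chi₁ g⁻¹ <;> cases chi₁ g <;> simp

@[simp] theorem chi₂_inv (g : Grig) : chi₂ g⁻¹ = chi₂ g := by
  have := chi₂_mul g⁻¹ g
  rw [inv_mul_cancel, chi₂_one] at this
  revert this; cases chi₂ g⁻¹ <;> cases chi₂ g <;> simp

@[simp] theorem chi₁_gA : chi₁ gA = false := by simp [chi₁]
@[simp] theorem chi₁_gB : chi₁ gB = true := by simp [chi₁]
@[simp] theorem chi₁_gC : chi₁ gC = true := by simp [chi₁]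
@[simp] theorem chi₁_gD : chi₁ gD = false := by simp [chi₁]
@[simp] theorem chi₂_gA : chi₂ gA = false := by simp [chi₂]
@[simp] theorem chi₂_gB : chi₂ gB = true := by simp [chi₂]
@[simp] theorem chi₂_gC : chi₂ gC = false := by simp [chi₂]
@[simp] theorem chi₂_gD : chi₂ gD = true := by simp [chi₂]

theorem swp_eq_false_of_mem_St {n : ℕ} {g : Grig} (hg : g ∈ St (n + 1)) : swp g = false :=
  (mem_St_succ.1 hg).1

theorem chi₁_eq_false_of_mem_St {n : ℕ} {g : Grig} (hg : g ∈ St (n + 2)) : chi₁ g = false := by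
  simp [chi₁, swp_eq_false_of_mem_St ((mem_St_succ.1 hg).2 _)]

theorem chi₂_eq_false_of_mem_St {n : ℕ} {g : Grig} (hg : g ∈ St (n + 3)) : chi₂ g = false := by
  simp [chi₂, chi₁_eq_false_of_mem_St ((mem_St_succ.1 hg).2 _)]

/-! ### The branching subgroup -/

/-- The branching subgroup, given by invariants of the action on the fourth level. -/
def K : Subgroup Grig where
  carrier := {g | swp g = false ∧ chi₁ g = false ∧ ∀ x, chi₂ (sec x g) = false}
  one_mem' := by simp
  mul_mem' := by
    rintro g h ⟨g1, g2, g3⟩ ⟨h1, h2, h3⟩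
    exact ⟨by simp [g1, h1], by simp [g2, h2], fun x ↦ by simp [h1, g3, h3]⟩
  inv_mem' := by
    rintro g ⟨g1, g2, g3⟩
    exact ⟨by simp [g1], by simp [g2], fun x ↦ by simp [g1, g3]⟩

theorem mem_K {g : Grig} :
    g ∈ K ↔ swp g = false ∧ chi₁ g = false ∧ ∀ x, chi₂ (sec x g) = false := Iff.rfl

theorem inv_mul_mem_K {g h : Grig} : g⁻¹ * h ∈ K ↔
    swp g = swp h ∧ chi₁ g = chi₁ h ∧ ∀ x, chi₂ (sec x g) = chi₂ (sec x h) := by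
  have key : ∀ p q : Bool, (p ^^ q) = false ↔ p = q := by decide
  rw [mem_K]
  simp only [swp_mul, swp_inv, sec_mul, sec_inv, chi₁_mul, chi₂_mul, chi₁_inv, chi₂_inv, key]
  constructor
  · rintro ⟨h1, h2, h3⟩
    exact ⟨h1, h2, fun x ↦ by simpa [h1] using h3 x⟩
  · rintro ⟨h1, h2, h3⟩
    exact ⟨h1, h2, fun x ↦ by simpa [h1] using h3 x⟩

instance K_normal : K.Normal where
  conj_mem g hg u := by
    refine ⟨by rw [swp_conj, hg.1], ?_, fun x ↦ ?_⟩
    · simp [hg.2.1]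
    · rw [sec_conj_of_swp_eq_false u hg.1]; simp [hg.2.2]

theorem St_le_K (n : ℕ) : St (n + 4) ≤ K := fun _ hg ↦
  ⟨swp_eq_false_of_mem_St (n := n + 3) hg, chi₁_eq_false_of_mem_St (n := n + 2) hg, fun x ↦
    chi₂_eq_false_of_mem_St (n := n) ((mem_St_succ.1 hg).2 x)⟩

instance finite_quotient_K : Finite (Grig ⧸ K) :=
  Finite.of_surjective (Subgroup.quotientMapOfLE (St_le_K 0)) fun q ↦ by
    obtain ⟨g, rfl⟩ := QuotientGroup.mk_surjective q
    exact ⟨(g : Grig ⧸ St 4), rfl⟩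

/-- The group is self-replicating: the sections of `b`, `c`, `d` and of their conjugates by `a`
include every generator at either vertex. -/
theorem exists_sec_eq (x : Bool) (s : Grig) : ∃ g, swp g = false ∧ sec x g = s := by
  have key : ∀ s t : Grig, (∃ g, swp g = false ∧ sec x g = s) → (∃ g, swp g = false ∧ sec x g = t) →
      ∃ g, swp g = false ∧ sec x g = s * t := by
    rintro s t ⟨g, g1, rfl⟩ ⟨h, h1, rfl⟩
    exact ⟨g * h, by simp [g1, h1], by simp [h1]⟩
  induction s using grig_induction with
  | one => exact ⟨1, by simp⟩
  | hA s ih =>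
    refine key _ _ ?_ ih
    cases x
    · exact ⟨gB, by simp⟩
    · exact ⟨gA * gB * gA, by simp⟩
  | hB s ih =>
    refine key _ _ ?_ ih
    cases x
    · exact ⟨gA * gD * gA, by simp⟩
    · exact ⟨gD, by simp⟩
  | hC s ih =>
    refine key _ _ ?_ ih
    cases x
    · exact ⟨gA * gB * gA, by simp⟩
    · exact ⟨gB, by simp⟩
  | hD s ih =>
    refine key _ _ ?_ ih
    cases x
    · exact ⟨gA * gC * gA, by simp⟩
    · exact ⟨gC, by simp⟩

/-- The sections at `x` of the elements of `N` that act trivially outside the subtree at `x`. -/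
def corner (x : Bool) (N : Subgroup Grig) : Subgroup Grig where
  carrier := {h | ∃ y ∈ N, swp y = false ∧ sec x y = h ∧ sec (!x) y = 1}
  one_mem' := ⟨1, one_mem _, by simp⟩
  mul_mem' := by
    rintro _ _ ⟨y, yN, y1, rfl, y2⟩ ⟨z, zN, z1, rfl, z2⟩
    exact ⟨y * z, mul_mem yN zN, by simp [*]⟩
  inv_mem' := by
    rintro _ ⟨y, yN, y1, rfl, y2⟩
    exact ⟨y⁻¹, inv_mem yN, by simp [*]⟩

instance corner_normal (x : Bool) (N : Subgroup Grig) [hN : N.Normal] : (corner x N).Normal where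
  conj_mem := by
    rintro _ ⟨y, yN, y1, rfl, y2⟩ s
    obtain ⟨g, g1, rfl⟩ := exists_sec_eq x s
    exact ⟨g * y * g⁻¹, hN.conj_mem y yN g, by simp [*]⟩

theorem corner_not_eq (x : Bool) (N : Subgroup Grig) [hN : N.Normal] : corner (!x) N = corner x N := by
  have : ∀ x, corner (!x) N ≤ corner x N := by
    rintro x _ ⟨y, yN, y1, rfl, y2⟩
    refine ⟨gA * y * gA⁻¹, hN.conj_mem y yN _, ?_⟩
    rw [Bool.not_not] at y2
    simp [y1, y2]
  exact le_antisymm (this x) (by simpa using this (!x))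

/-- The element `abab`, whose normal closure is the branching subgroup. -/
def tt : Grig := gA * gB * gA * gB

theorem gA_mul_gD_pow_four : (gA * gD) ^ 4 = 1 := by
  have h : (gA * gD) ^ 2 * (gA * gD) ^ 2 = 1 := by
    apply sec_ext
    · simp [pow_two]
    · intro x; cases x <;> simp [pow_two]
  rw [← h, ← pow_add]

theorem mem_K_tt : tt ∈ K := by
  refine ⟨by simp [tt], by simp [tt], fun x ↦ ?_⟩
  cases x <;> simp [tt]

/-- Once `abab` is killed, `b` commutes with `a`, and it always commutes with `d`. The quotient is
then generated by a central `b` and the dihedral group of `a` and `d`, whence the normal form. -/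
theorem exists_rep (g : Grig) : ∃ i j k : ℤ,
    (gB ^ i * (gA * gD) ^ j * gA ^ k)⁻¹ * g ∈ Subgroup.normalClosure {tt} := by
  set T := Subgroup.normalClosure {tt} with hT
  let π := QuotientGroup.mk' T
  have hAA : π gA * π gA = 1 := by rw [← map_mul, gA_mul_gA, map_one]
  have hBB : π gB * π gB = 1 := by rw [← map_mul, gB_mul_gB, map_one]
  have hDD : π gD * π gD = 1 := by rw [← map_mul, gD_mul_gD, map_one]
  have hA' : (π gA)⁻¹ = π gA := inv_eq_of_mul_eq_one_left hAA
  have hB' : (π gB)⁻¹ = π gB := inv_eq_of_mul_eq_one_left hBB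
  have hD' : (π gD)⁻¹ = π gD := inv_eq_of_mul_eq_one_left hDD
  have hAB : Commute (π gA) (π gB) := by
    have h : π gA * π gB * π gA * π gB = 1 := by
      simp only [← map_mul]
      exact (QuotientGroup.eq_one_iff _).2 (Subgroup.subset_normalClosure rfl)
    have := eq_inv_of_mul_eq_one_left h
    rw [hB'] at this
    have := eq_mul_inv_of_mul_eq this
    rwa [hA'] at this
  have hDB : Commute (π gD) (π gB) := by
    rw [Commute, SemiconjBy, ← map_mul, ← map_mul, gD_mul_gB, gB_mul_gD]
  have conjA : ∀ j : ℤ, π gA * (π gA * π gD) ^ j = (π gA * π gD) ^ (-j) * π gA := by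
    intro j
    have : SemiconjBy (π gA) (π gA * π gD) (π gA * π gD)⁻¹ := by
      rw [SemiconjBy, mul_inv_rev, hA', hD', ← mul_assoc, hAA, one_mul, mul_assoc, hAA, mul_one]
    have := this.zpow_right j
    rwa [inv_zpow, ← zpow_neg] at this
  have key : ∀ g, ∃ i j k : ℤ, π g = π gB ^ i * (π gA * π gD) ^ j * π gA ^ k := by
    have stepA : ∀ g, (∃ i j k : ℤ, π g = π gB ^ i * (π gA * π gD) ^ j * π gA ^ k) →
        ∃ i j k : ℤ, π gA * π g = π gB ^ i * (π gA * π gD) ^ j * π gA ^ k := by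
      rintro g ⟨i, j, k, h⟩
      refine ⟨i, -j, 1 + k, ?_⟩
      rw [h, mul_assoc, ← mul_assoc, (hAB.zpow_right i).eq, mul_assoc, ← mul_assoc (π gA), conjA,
        zpow_add, zpow_one, mul_assoc, mul_assoc]
    have stepB : ∀ q, (∃ i j k : ℤ, q = π gB ^ i * (π gA * π gD) ^ j * π gA ^ k) →
        ∃ i j k : ℤ, π gB * q = π gB ^ i * (π gA * π gD) ^ j * π gA ^ k := by
      rintro _ ⟨i, j, k, rfl⟩
      exact ⟨1 + i, j, k, by rw [zpow_add, zpow_one]; simp only [mul_assoc]⟩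
    have stepD : ∀ g, (∃ i j k : ℤ, π g = π gB ^ i * (π gA * π gD) ^ j * π gA ^ k) →
        ∃ i j k : ℤ, π gD * π g = π gB ^ i * (π gA * π gD) ^ j * π gA ^ k := by
      rintro g ⟨i, j, k, h⟩
      refine ⟨i, -(1 + j), 1 + k, ?_⟩
      have e : π gD = π gA * (π gA * π gD) := by rw [← mul_assoc, hAA, one_mul]
      calc π gD * π g = π gB ^ i * (π gD * (π gA * π gD) ^ j) * π gA ^ k := by
            rw [h, mul_assoc, ← mul_assoc, (hDB.zpow_right i).eq]; simp only [mul_assoc]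
        _ = π gB ^ i * (π gA * (π gA * π gD) ^ (1 + j)) * π gA ^ k := by
            rw [zpow_add, zpow_one, ← mul_assoc (π gA), ← e]
        _ = _ := by rw [conjA, zpow_add (π gA), zpow_one]; simp only [mul_assoc]
    intro g
    induction g using grig_induction with
    | one => exact ⟨0, 0, 0, by simp⟩
    | hA g ih => rw [map_mul]; exact stepA g ih
    | hB g ih => rw [map_mul]; exact stepB _ ih
    | hC g ih =>
      rw [← gB_mul_gD, mul_assoc, map_mul, map_mul]; exact stepB _ (stepD g ih)
    | hD g ih => rw [map_mul]; exact stepD g ih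
  obtain ⟨i, j, k, h⟩ := key g
  exact ⟨i, j, k, QuotientGroup.eq.1 (by simpa [π] using h.symm)⟩

/-- Modulo the normal closure there are at most 2 · 4 · 2 representatives, and the invariants
defining `K` exclude all of them but the trivial one. -/
theorem K_eq_normalClosure : K = Subgroup.normalClosure {tt} := by
  have hle : Subgroup.normalClosure {tt} ≤ K :=
    Subgroup.normalClosure_le_normal (by simpa using mem_K_tt)
  refine le_antisymm (fun g hg ↦ ?_) hle
  obtain ⟨i, j, k, h⟩ := exists_rep g
  rw [zpow_eq_zpow_emod i (n := 2) (by rw [zpow_ofNat, pow_two, gB_mul_gB]),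
    zpow_eq_zpow_emod k (n := 2) (by rw [zpow_ofNat, pow_two, gA_mul_gA]),
    zpow_eq_zpow_emod j (n := 4) (by rw [zpow_ofNat, gA_mul_gD_pow_four])] at h
  have hw : gB ^ (i % 2) * (gA * gD) ^ (j % 4) * gA ^ (k % 2) ∈ K := by
    have := mul_mem hg (inv_mem (hle h))
    simpa using this
  have hi : i % 2 = 0 ∨ i % 2 = 1 := by omega
  have hk : k % 2 = 0 ∨ k % 2 = 1 := by omega
  have hj : j % 4 = 0 ∨ j % 4 = 1 ∨ j % 4 = 2 ∨ j % 4 = 3 := by omega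
  rw [mem_K, Bool.forall_bool] at hw
  generalize i % 2 = i at *
  generalize j % 4 = j at *
  generalize k % 2 = k at *
  rcases hi with rfl | rfl <;> rcases hj with rfl | rfl | rfl | rfl <;> rcases hk with rfl | rfl <;>
    simp [zpow_ofNat, pow_succ] at hw
  simpa using h

/-- This is the branching property. The corner is normal because the group is self-replicating, so
one conjugate of the normal generator `abab` is enough. -/
theorem K_le_corner (x : Bool) : K ≤ corner x K := by
  have h : K ≤ corner false K := by
    conv_lhs => rw [K_eq_normalClosure]
    refine Subgroup.normalClosure_le_normal (Set.singleton_subset_iff.2 ?_)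
    have : gD * tt * gD ∈ corner false K := by
      -- The commutator of `ada` and `abab`: their sections are (b, 1) and (ca, ac), so it is
      -- trivial at `true` and equals bcabac = d(abab)d at `false`.
      refine ⟨gA * gD * gA * tt * (gA * gD * gA)⁻¹ * tt⁻¹,
        mul_mem (K_normal.conj_mem _ mem_K_tt _) (inv_mem mem_K_tt), ?_, ?_, ?_⟩ <;>
        simp [tt, mul_assoc]
    simpa [mul_assoc] using (corner_normal false K).conj_mem _ this gD
  cases x
  · exact h
  · exact h.trans (corner_not_eq false K).ge

theorem exists_mem_K_sec {k : Bool → Grig} (hk : ∀ x, k x ∈ K) :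
    ∃ y ∈ K, swp y = false ∧ ∀ x, sec x y = k x := by
  obtain ⟨y, yK, y1, y2, y3⟩ := K_le_corner false (hk false)
  obtain ⟨z, zK, z1, z2, z3⟩ := K_le_corner true (hk true)
  refine ⟨y * z, mul_mem yK zK, by simp [y1, z1], fun x ↦ ?_⟩
  simp only [Bool.not_false, Bool.not_true] at y3 z3
  cases x <;> simp [*]

theorem below_K_le_K : below K ≤ K := by
  intro g hg
  obtain ⟨y, yK, y1, y2⟩ := exists_mem_K_sec hg.2
  rwa [sec_ext (y1.trans hg.1.symm) y2] at yK

/-- The product of the copies of `K` at the vertices of level `n`. -/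
def Kn (n : ℕ) : Subgroup Grig := below^[n] K

theorem Kn_succ (n : ℕ) : Kn (n + 1) = below (Kn n) := Function.iterate_succ_apply' _ _ _

instance Kn_normal (n : ℕ) : (Kn n).Normal := by
  induction n with
  | zero => exact K_normal
  | succ n ih => rw [Kn_succ]; infer_instance

instance finite_quotient_Kn (n : ℕ) : Finite (Grig ⧸ Kn n) := by
  induction n with
  | zero => exact finite_quotient_K
  | succ n ih => rw [Kn_succ]; exact finite_quotient_below _

theorem Kn_le_K (n : ℕ) : Kn n ≤ K := by
  induction n with
  | zero => exact le_rfl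
  | succ n ih => rw [Kn_succ]; exact (below_mono ih).trans below_K_le_K

theorem St_le_Kn (n : ℕ) : St (n + 4) ≤ Kn n := by
  induction n with
  | zero => exact St_le_K 0
  | succ n ih =>
    rw [Kn_succ, show n + 1 + 4 = n + 4 + 1 by omega, St_succ]; exact below_mono ih

theorem exists_mem_Kn_sec {n : ℕ} {k : Bool → Grig} (hk : ∀ x, k x ∈ Kn n) :
    ∃ y ∈ Kn (n + 1), swp y = false ∧ ∀ x, sec x y = k x := by
  obtain ⟨y, -, y1, y2⟩ := exists_mem_K_sec fun x ↦ Kn_le_K n (hk x)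
  exact ⟨y, by rw [Kn_succ]; exact ⟨y1, fun x ↦ by rw [y2]; exact hk x⟩, y1, y2⟩

/-! ### Approximate conjugacy -/

/-- In every congruence quotient, `g` and `x` are conjugate by an element of the coset `v R`. -/
def ApproxConj (R : Subgroup Grig) (g x v : Grig) : Prop :=
  ∀ m, ∃ u, v⁻¹ * u ∈ R ∧ u * g * u⁻¹ * x⁻¹ ∈ St m

/-- For every coset of `R`, if `g` and `x` are conjugate in all congruence quotients by elements
of the coset, then they are conjugate by an element of the coset. -/
def ConjDetected (R : Subgroup Grig) (g x : Grig) : Prop :=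
  ∀ v, ApproxConj R g x v → ∃ u, v⁻¹ * u ∈ R ∧ u * g * u⁻¹ = x

theorem exists_forall_of_antitone {ι : Type*} [Finite ι] {P : ℕ → ι → Prop}
    (anti : ∀ m n i, m ≤ n → P n i → P m i) (h : ∀ m, ∃ i, P m i) : ∃ i, ∀ m, P m i := by
  by_contra! hc
  choose f hf using hc
  cases nonempty_fintype ι
  obtain ⟨i, hi⟩ := h (Finset.univ.sup f)
  exact hf i (anti _ _ i (Finset.le_sup (Finset.mem_univ i)) hi)

/-- A coset of `S` meets only finitely many cosets of `R`. The approximations get finer with the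
level, so by pigeonhole one coset of `R` serves all levels. -/
theorem ConjDetected.mono {R S : Subgroup Grig} [Finite (Grig ⧸ R)] (hRS : R ≤ S) {g x : Grig}
    (h : ConjDetected R g x) : ConjDetected S g x := by
  intro v hv
  obtain ⟨q, hq⟩ := exists_forall_of_antitone (ι := Grig ⧸ R)
    (P := fun m q ↦ ∃ u : Grig, (u : Grig ⧸ R) = q ∧ v⁻¹ * u ∈ S ∧ u * g * u⁻¹ * x⁻¹ ∈ St m)
    (fun m n _ hmn ⟨u, h1, h2, h3⟩ ↦ ⟨u, h1, h2, St_antitone hmn h3⟩)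
    (fun m ↦ let ⟨u, h1, h2⟩ := hv m; ⟨_, u, rfl, h1, h2⟩)
  obtain ⟨w, rfl, hw, -⟩ := hq 0
  obtain ⟨u, hu, hux⟩ := h w fun m ↦ by
    obtain ⟨u, h1, -, h3⟩ := hq m
    exact ⟨u, QuotientGroup.eq.1 h1.symm, h3⟩
  exact ⟨u, by simpa [mul_assoc] using mul_mem hw (hRS hu), hux⟩

theorem ConjDetected.of_conj {R : Subgroup Grig} [hR : R.Normal] {g x g' x' : Grig} (hg : IsConj g g')
    (hx : IsConj x x') (h : ConjDetected R g' x') : ConjDetected R g x := by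
  obtain ⟨p, rfl⟩ := isConj_iff.1 hg
  obtain ⟨q, rfl⟩ := isConj_iff.1 hx
  intro v hv
  obtain ⟨u, h1, h2⟩ := h (q * v * p⁻¹) fun m ↦ by
    obtain ⟨u, h1, h2⟩ := hv m
    refine ⟨q * u * p⁻¹, ?_, ?_⟩
    · convert hR.conj_mem _ h1 p using 1; group
    · convert (St_normal m).conj_mem _ h2 q using 1; group
  refine ⟨q⁻¹ * u * p, ?_, ?_⟩
  · convert hR.conj_mem _ h1 p⁻¹ using 1; group
  · rw [← mul_right_inj q, ← mul_left_inj q⁻¹, ← h2]; group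

theorem ApproxConj.swp_eq {R : Subgroup Grig} {g x v : Grig} (h : ApproxConj R g x v) :
    swp g = swp x := by
  obtain ⟨u, -, hu⟩ := h 1
  have := swp_eq_false_of_mem_St hu
  rw [swp_mul, swp_conj, swp_inv] at this
  revert this; cases swp g <;> cases swp x <;> simp

theorem ApproxConj.chi₁_eq {R : Subgroup Grig} {g x v : Grig} (h : ApproxConj R g x v) :
    chi₁ g = chi₁ x := by
  obtain ⟨u, -, hu⟩ := h 2
  have := chi₁_eq_false_of_mem_St hu
  simp only [chi₁_mul, chi₁_inv] at this
  revert this; cases chi₁ g <;> cases chi₁ x <;> cases chi₁ u <;> simp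

theorem ApproxConj.chi₂_eq {R : Subgroup Grig} {g x v : Grig} (h : ApproxConj R g x v) :
    chi₂ g = chi₂ x := by
  obtain ⟨u, -, hu⟩ := h 3
  have := chi₂_eq_false_of_mem_St hu
  simp only [chi₂_mul, chi₂_inv] at this
  revert this; cases chi₂ g <;> cases chi₂ x <;> cases chi₂ u <;> simp

theorem ConjDetected.one_left (R : Subgroup Grig) (x : Grig) : ConjDetected R 1 x := by
  intro v hv
  have : x⁻¹ = 1 := eq_one_of_mem_St fun m ↦ by
    obtain ⟨u, -, h⟩ := hv m
    simpa using h
  exact ⟨v, by simp [one_mem], by simpa [eq_comm] using this⟩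

theorem ConjDetected.one_right (R : Subgroup Grig) (g : Grig) : ConjDetected R g 1 := by
  intro v hv
  have : g = 1 := eq_one_of_mem_St fun m ↦ by
    obtain ⟨u, -, h⟩ := hv m
    have := (St_normal m).conj_mem _ h u⁻¹
    simpa [mul_assoc] using this
  exact ⟨v, by simp [one_mem], by simp [this]⟩

/-- Approximate conjugators have sections that approximately conjugate the sections of `g` to those
of `x`. The exact conjugators found there differ from the sections of `v` by elements of `Kn n`, and
branching realises these corrections by a single element of `Kn (n + 1)`. -/
theorem conjDetected_of_sec {n : ℕ} {g x : Grig} (hg : swp g = false)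
    (h : ∀ i j, ConjDetected (Kn n) (sec i g) (sec j x)) : ConjDetected (Kn (n + 1)) g x := by
  intro v hv
  have hx : swp x = false := hv.swp_eq ▸ hg
  have key : ∀ i, ∃ w, (sec i v)⁻¹ * w ∈ Kn n ∧
      w * sec i g * w⁻¹ = sec (i ^^ swp v) x := by
    intro i
    refine h i _ _ fun m ↦ ?_
    obtain ⟨u, h1, h2⟩ := hv (m + 1)
    rw [Kn_succ, inv_mul_mem_below] at h1
    refine ⟨sec i u, h1.2 i, ?_⟩
    have := (mem_St_succ.1 h2).2 (i ^^ swp v)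
    rw [sec_mul, sec_inv, swp_inv, hx, Bool.xor_false, sec_conj_of_swp_eq_false _ hg, ← h1.1,
      Bool.xor_assoc, Bool.xor_self, Bool.xor_false] at this
    exact this
  choose w hw1 hw2 using key
  obtain ⟨k, k1, k2, k3⟩ := exists_mem_Kn_sec hw1
  refine ⟨v * k, by simpa using k1, sec_ext (by rw [swp_conj, hg, hx]) fun i ↦ ?_⟩
  rw [sec_conj_of_swp_eq_false _ hg]
  have := hw2 (i ^^ swp v)
  rw [Bool.xor_assoc, Bool.xor_self, Bool.xor_false] at this
  simp [k2, k3, ← this]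

/-- When `g` swaps, one section of a conjugator determines the other, and the only remaining
equation says that the section at `false` conjugates the section of `g²` to that of `x²` at the
image vertex. -/
theorem conjDetected_of_sec_mul_sec {n : ℕ} {g x : Grig} (hg : swp g = true)
    (h : ∀ i, ConjDetected (Kn n) (sec true g * sec false g) (sec (!i) x * sec i x)) :
    ConjDetected (Kn (n + 1)) g x := by
  intro v hv
  have hx : swp x = true := hv.swp_eq ▸ hg
  set e := swp v with he
  have sec_rel : ∀ m, ∃ u, v⁻¹ * u ∈ Kn (n + 1) ∧ ∀ i,
      sec (!i) u * sec i g * (sec i u)⁻¹ * (sec (i ^^ e) x)⁻¹ ∈ St m := by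
    intro m
    obtain ⟨u, h1, h2⟩ := hv (m + 1)
    refine ⟨u, h1, fun i ↦ ?_⟩
    rw [Kn_succ, inv_mul_mem_below] at h1
    have := (mem_St_succ.1 h2).2 (!(i ^^ e))
    simpa [hx, hg, ← h1.1, ← he, Bool.xor_assoc] using this
  obtain ⟨w, hw1, hw2⟩ := h e (sec false v) fun m ↦ by
    obtain ⟨u, h1, h2⟩ := sec_rel m
    rw [Kn_succ, inv_mul_mem_below] at h1
    refine ⟨sec false u, h1.2 _, ?_⟩
    have a0 := h2 false
    have a1 := h2 true
    simp only [Bool.not_false, Bool.not_true, Bool.false_xor, Bool.true_xor] at a0 a1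
    have := mul_mem a1 ((St_normal m).conj_mem _ a0 (sec (!e) x))
    convert this using 1
    group
  -- The section forced at `true` must also lie in the prescribed coset. This may be checked modulo
  -- `Kn n`, where an approximate solution at level `n + 4` is already exact because `St (n + 4) ≤
  -- Kn n`.
  have hw1' : (sec true v)⁻¹ * (sec e x * w * (sec false g)⁻¹) ∈ Kn n := by
    obtain ⟨u, h1, h2⟩ := sec_rel (n + 4)
    rw [Kn_succ, inv_mul_mem_below] at h1
    have a0 := St_le_Kn n (h2 false)
    simp only [Bool.not_false, Bool.false_xor] at a0
    have b0 := h1.2 true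
    have b1 := h1.2 false
    have N := Kn_normal n
    rw [← QuotientGroup.eq_one_iff] at *
    simp only [QuotientGroup.mk_mul, QuotientGroup.mk_inv] at *
    rw [inv_mul_eq_one] at *
    rw [b0, ← hw1, b1]
    rw [mul_inv_eq_one, mul_inv_eq_iff_eq_mul] at a0
    rw [← a0, mul_inv_cancel_right]
  let k : Bool → Grig := fun i ↦ bif i then (sec true v)⁻¹ * (sec e x * w * (sec false g)⁻¹) else
    (sec false v)⁻¹ * w
  obtain ⟨y, y1, y2, y3⟩ := exists_mem_Kn_sec (k := k) (n := n) (by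
    intro i; cases i
    · exact hw1
    · exact hw1')
  refine ⟨v * y, by simpa using y1, ?_⟩
  have s0 : sec false (v * y) = w := by simp [y2, y3, k]
  have s1 : sec true (v * y) = sec e x * w * (sec false g)⁻¹ := by simp [y2, y3, k]
  rw [mul_inv_eq_iff_eq_mul]
  have hs : swp (v * y) = e := by simp [y2, he]
  refine sec_ext (by rw [swp_mul _ g, swp_mul x, hg, hx, Bool.xor_comm]) fun i ↦ ?_
  rw [sec_mul i _ g, sec_mul i x, hg, hs]
  cases i
  · simp [s0, s1]
  · simp only [Bool.xor_self, Bool.true_xor, s0, s1]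
    rw [← mul_assoc, ← mul_assoc, ← hw2]; group

theorem conjDetected_K_of_Kn_one {g x : Grig} (h : ConjDetected (Kn 1) g x) : ConjDetected K g x :=
  h.mono (Kn_le_K 1)

/-! ### The generators `b`, `c`, `d` -/

/-- The commutator of `u` with `a` has as section at `true` a quotient of the two sections of `u`,
on which `chi₁` takes the value `chi₂ u`. -/
theorem chi₂_eq_false_of_comm_gA {u : Grig} {n : ℕ} (h : u * gA * u⁻¹ * gA⁻¹ ∈ St (n + 4)) :
    chi₂ u = false := by
  have h1 := chi₁_eq_false_of_mem_St (n := n + 1) ((mem_St_succ.1 h).2 true)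
  revert h1
  simp only [sec_mul, sec_inv, sec_gA, chi₁_mul, chi₁_inv, chi₁_one, gA_inv, swp_inv, swp_gA, chi₂]
  cases swp u <;> simp [Bool.xor_comm]

/-- Covers `b` and `c`. An approximate centraliser of `y` cannot swap, since only one section of `y`
swaps, and its section at `false` approximately commutes with `a`. Two of the four invariants of its
coset are thus forced. -/
theorem conjDetected_of_sec_false_eq_gA {y : Grig} (hy : swp y = false) (hy0 : sec false y = gA)
    (hz : swp (sec true y) = false) (hb : gB * y = y * gB) (hd : gD * y = y * gD) :
    ConjDetected K y y := by
  intro v hv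
  obtain ⟨u, h1, h2⟩ := hv 5
  rw [inv_mul_mem_K] at h1
  have h3 := (mem_St_succ.1 h2).2
  have hu : swp u = false := by
    by_contra hu
    rw [Bool.not_eq_false] at hu
    have h4 := swp_eq_false_of_mem_St (n := 3) (h3 false)
    rw [sec_mul, swp_inv, hy, Bool.xor_false, sec_conj_of_swp_eq_false u hy, swp_mul, swp_conj, hu, sec_inv, hy, swp_inv,
      Bool.xor_false, hy0] at h4
    simp [hz] at h4
  have h4 := h3 false
  rw [sec_mul, swp_inv, hy, Bool.xor_false, sec_conj_of_swp_eq_false u hy, hu, sec_inv, hy,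
    Bool.xor_false, hy0] at h4
  have h5 := chi₂_eq_false_of_comm_gA (n := 0) h4
  have of_comm : ∀ w, w * y = y * w → swp w = false → chi₂ (sec false w) = false →
      chi₁ w = chi₁ v → chi₂ (sec true w) = chi₂ (sec true v) → ∃ w, v⁻¹ * w ∈ K ∧ w * y * w⁻¹ = y := by
    intro w w1 w2 w3 w4 w5
    refine ⟨w, inv_mul_mem_K.2 ⟨?_, w4.symm, ?_⟩, by rw [w1, mul_inv_cancel_right]⟩
    · rw [w2, h1.1, hu]
    · rw [Bool.forall_bool, w5, w3, h1.2.2, h5]; exact ⟨rfl, rfl⟩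
  have hc : gC * y = y * gC := by rw [← gB_mul_gD, mul_assoc, hd, ← mul_assoc, hb, mul_assoc]
  -- The two free invariants take all four values on 1, `d`, `b`, `c`, which commute with `y`.
  rcases h6 : chi₁ v <;> rcases h7 : chi₂ (sec true v)
  · exact of_comm 1 (by simp) (by simp) (by simp) (by simp [h6]) (by simp [h7])
  · exact of_comm gD hd (by simp) (by simp) (by simp [h6]) (by simp [h7])
  · exact of_comm gB hb (by simp) (by simp) (by simp [h6]) (by simp [h7])
  · exact of_comm gC hc (by simp) (by simp) (by simp [h6]) (by simp [h7])

theorem conjDetected_gB : ConjDetected K gB gB :=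
  conjDetected_of_sec_false_eq_gA (by simp) (by simp) (by simp) (by simp) (by simp)

theorem conjDetected_gC : ConjDetected K gC gC :=
  conjDetected_of_sec_false_eq_gA (by simp) (by simp) (by simp) (by simp) (by simp)

theorem conjDetected_gD : ConjDetected K gD gD := by
  intro v hv
  obtain ⟨u, h1, h2⟩ := hv 5
  rw [inv_mul_mem_K] at h1
  have hu : swp u = false := by
    by_contra hu
    rw [Bool.not_eq_false] at hu
    have h4 := chi₁_eq_false_of_mem_St (n := 2) ((mem_St_succ.1 h2).2 false)
    simp [hu] at h4
  have comm : gA * gD * gA * gD = gD * (gA * gD * gA) := by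
    apply sec_ext
    · simp
    · intro x; cases x <;> simp
  have of_comm : ∀ w, w * gD = gD * w → swp w = false → chi₂ (sec false w) = chi₂ (sec false v) →
      chi₁ w = chi₁ v → chi₂ (sec true w) = chi₂ (sec true v) →
      ∃ w, v⁻¹ * w ∈ K ∧ w * gD * w⁻¹ = gD := by
    intro w w1 w2 w3 w4 w5
    refine ⟨w, inv_mul_mem_K.2 ⟨?_, w4.symm, ?_⟩, by rw [w1, mul_inv_cancel_right]⟩
    · rw [w2, h1.1, hu]
    · rw [Bool.forall_bool, w5, w3]; exact ⟨rfl, rfl⟩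
  have of_comm' : ∀ w, w * gD = gD * w → swp w = false → chi₂ (sec false w) = false →
      chi₁ w = chi₁ v → chi₂ (sec true w) = chi₂ (sec true v) →
      ∃ w, v⁻¹ * w ∈ K ∧ w * gD * w⁻¹ = gD := by
    intro w w1 w2 w3 w4 w5
    rcases h8 : chi₂ (sec false v)
    · exact of_comm w w1 w2 (w3.trans h8.symm) w4 w5
    -- Here the section at `false` is unconstrained. The element `ada`, with sections (b, 1),
    -- commutes with `d` and changes only that invariant.
    · refine of_comm (gA * gD * gA * w) ?_ (by simp [w2]) (by simp [w2, w3, h8]) (by simp [w4])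
        (by simp [w2, w5])
      rw [mul_assoc, w1, ← mul_assoc, comm, mul_assoc gD]
  rcases h6 : chi₁ v <;> rcases h7 : chi₂ (sec true v)
  · exact of_comm' 1 (by simp) (by simp) (by simp) (by simp [h6]) (by simp [h7])
  · exact of_comm' gD (by simp) (by simp) (by simp) (by simp [h6]) (by simp [h7])
  · exact of_comm' gB (by simp) (by simp) (by simp) (by simp [h6]) (by simp [h7])
  · exact of_comm' gC (by simp) (by simp) (by simp) (by simp [h6]) (by simp [h7])

theorem conjDetected_of_chi_ne {g x : Grig} (h : chi₁ g ≠ chi₁ x ∨ chi₂ g ≠ chi₂ x) :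
    ConjDetected K g x :=
  fun _ hv ↦ (h.elim (· hv.chi₁_eq) (· hv.chi₂_eq)).elim

/-! ### Weighted words -/

/-- The generators `b`, `c`, `d`, as symbols. -/
inductive Star | b | c | d

namespace Star

def val : Star → Grig
  | b => gB
  | c => gC
  | d => gD

/-- With weight 3 for `a`, each syllable `sa` outweighs the total contribution of `s` to the two
sections by exactly one. The strict triangle inequalities among 5, 4, 3 make merging two of `b`,
`c`, `d` lower the weight. -/
def weight : Star → ℕ
  | b => 5
  | c => 4
  | d => 3

/-- The symbol of the section at `true`. -/
def next : Star → Star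
  | b => c
  | c => d
  | d => b

/-- A word for the section at `false`; the symbol `none` stands for `a`. -/
def left : Star → List (Option Star)
  | b => [none]
  | c => [none]
  | d => []

end Star

def letterVal : Option Star → Grig
  | none => gA
  | some s => s.val

def letterWeight : Option Star → ℕ
  | none => 3
  | some s => s.weight

/-- The element given by a word. -/
def eval (w : List (Option Star)) : Grig := (w.map letterVal).prod

def wt (w : List (Option Star)) : ℕ := (w.map letterWeight).sum

@[simp] theorem eval_nil : eval [] = 1 := rfl
@[simp] theorem wt_nil : wt [] = 0 := rfl
@[simp] theorem eval_cons (y : Option Star) (w) : eval (y :: w) = letterVal y * eval w := by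
  simp [eval]
@[simp] theorem wt_cons (y : Option Star) (w) : wt (y :: w) = letterWeight y + wt w := by
  simp [wt]
@[simp] theorem eval_append (w w') : eval (w ++ w') = eval w * eval w' := by simp [eval]
@[simp] theorem wt_append (w w') : wt (w ++ w') = wt w + wt w' := by simp [wt]

theorem exists_eval_eq (g : Grig) : ∃ w, eval w = g := by
  induction g using grig_induction with
  | one => exact ⟨[], rfl⟩
  | hA g ih => obtain ⟨w, rfl⟩ := ih; exact ⟨none :: w, by simp [letterVal]⟩
  | hB g ih => obtain ⟨w, rfl⟩ := ih; exact ⟨some .b :: w, by simp [letterVal, Star.val]⟩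
  | hC g ih => obtain ⟨w, rfl⟩ := ih; exact ⟨some .c :: w, by simp [letterVal, Star.val]⟩
  | hD g ih => obtain ⟨w, rfl⟩ := ih; exact ⟨some .d :: w, by simp [letterVal, Star.val]⟩

/-- The word `s₁ a s₂ a … sₖ a`. -/
def altWord : List Star → List (Option Star)
  | [] => []
  | s :: l => some s :: none :: altWord l

theorem altWord_append (l l' : List Star) : altWord (l ++ l') = altWord l ++ altWord l' := by
  induction l with
  | nil => rfl
  | cons s l ih => simp [altWord, ih]

theorem exists_merge (y z : Option Star) (h : y.isSome = z.isSome) :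
    ∃ m, eval m = eval [y, z] ∧ wt m < wt [y, z] := by
  match y, z, h with
  | none, none, _ => exact ⟨[], by simp [letterVal, letterWeight]⟩
  | some .b, some .b, _ => exact ⟨[], by simp [letterVal, Star.val, letterWeight, Star.weight]⟩
  | some .b, some .c, _ =>
    exact ⟨[some .d], by simp [letterVal, Star.val, letterWeight, Star.weight]⟩
  | some .b, some .d, _ =>
    exact ⟨[some .c], by simp [letterVal, Star.val, letterWeight, Star.weight]⟩
  | some .c, some .b, _ =>
    exact ⟨[some .d], by simp [letterVal, Star.val, letterWeight, Star.weight]⟩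
  | some .c, some .c, _ => exact ⟨[], by simp [letterVal, Star.val, letterWeight, Star.weight]⟩
  | some .c, some .d, _ =>
    exact ⟨[some .b], by simp [letterVal, Star.val, letterWeight, Star.weight]⟩
  | some .d, some .b, _ =>
    exact ⟨[some .c], by simp [letterVal, Star.val, letterWeight, Star.weight]⟩
  | some .d, some .c, _ =>
    exact ⟨[some .b], by simp [letterVal, Star.val, letterWeight, Star.weight]⟩
  | some .d, some .d, _ => exact ⟨[], by simp [letterVal, Star.val, letterWeight, Star.weight]⟩

theorem exists_alternating (w : List (Option Star)) :
    (∃ u y z v, w = u ++ y :: z :: v ∧ y.isSome = z.isSome) ∨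
    (∃ l, w = altWord l) ∨ (∃ l, w = none :: altWord l) ∨
    (∃ l s, w = altWord l ++ [some s]) ∨ (∃ l s, w = none :: altWord l ++ [some s]) := by
  induction w with
  | nil => exact .inr (.inl ⟨[], rfl⟩)
  | cons y w ih =>
    rcases ih with ⟨u, y', z, v, rfl, h⟩ | ⟨l, rfl⟩ | ⟨l, rfl⟩ | ⟨l, s, rfl⟩ | ⟨l, s, rfl⟩
    · exact .inl ⟨y :: u, y', z, v, rfl, h⟩
    · rcases y with _ | s
      · exact .inr (.inr (.inl ⟨l, rfl⟩))
      · rcases l with _ | ⟨s', l⟩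
        · exact .inr (.inr (.inr (.inl ⟨[], s, rfl⟩)))
        · exact .inl ⟨[], some s, some s', none :: altWord l, rfl, rfl⟩
    · rcases y with _ | s
      · exact .inl ⟨[], none, none, altWord l, rfl, rfl⟩
      · exact .inr (.inl ⟨s :: l, rfl⟩)
    · rcases y with _ | s'
      · exact .inr (.inr (.inr (.inr ⟨l, s, rfl⟩)))
      · rcases l with _ | ⟨s'', l⟩
        · exact .inl ⟨[], some s', some s, [], rfl, rfl⟩
        · exact .inl ⟨[], some s', some s'', none :: altWord l ++ [some s], rfl, rfl⟩
    · rcases y with _ | s'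
      · exact .inl ⟨[], none, none, altWord l ++ [some s], rfl, rfl⟩
      · exact .inr (.inr (.inr (.inl ⟨s' :: l, s, rfl⟩)))

/-- `g` is trivial, or a generator or a cyclically alternating word, of weight at most `n`. -/
def NormalForm (g : Grig) (n : ℕ) : Prop :=
  g = 1 ∨ g = gA ∨ (∃ s : Star, g = s.val ∧ s.weight ≤ n) ∨
    ∃ l, l ≠ [] ∧ g = eval (altWord l) ∧ wt (altWord l) ≤ n

theorem NormalForm.mono {g : Grig} {m n : ℕ} (h : NormalForm g m) (hmn : m ≤ n) : NormalForm g n := by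
  rcases h with h | h | ⟨s, h, h'⟩ | ⟨l, h0, h, h'⟩
  · exact .inl h
  · exact .inr (.inl h)
  · exact .inr (.inr (.inl ⟨s, h, h'.trans hmn⟩))
  · exact .inr (.inr (.inr ⟨l, h0, h, h'.trans hmn⟩))

theorem isConj_of_eq {g h : Grig} (e : g = h) : IsConj g h := e ▸ IsConj.refl g

theorem isConj_mul_comm (g h : Grig) : IsConj (g * h) (h * g) :=
  isConj_iff.2 ⟨h, by group⟩

/-- Merging adjacent letters of the same kind lowers the weight. In an alternating word, conjugation
rotates the first letter to the end, which either creates another merge or gives a cyclically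
alternating word. -/
theorem exists_normalForm (w : List (Option Star)) : ∃ g, IsConj (eval w) g ∧ NormalForm g (wt w) := by
  induction hn : wt w using Nat.strong_induction_on generalizing w with
  | _ n ih =>
  subst hn
  have reduce : ∀ w', IsConj (eval w) (eval w') → wt w' < wt w →
      ∃ g, IsConj (eval w) g ∧ NormalForm g (wt w) := by
    intro w' h1 h2
    obtain ⟨g, hg, hg'⟩ := ih _ h2 w' rfl
    exact ⟨g, h1.trans hg, hg'.mono h2.le⟩
  rcases exists_alternating w with ⟨u, y, z, v, rfl, h⟩ | ⟨l, rfl⟩ | ⟨l, rfl⟩ | ⟨l, s, rfl⟩ | ⟨l, s, rfl⟩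
  · obtain ⟨m, m1, m2⟩ := exists_merge y z h
    refine reduce (u ++ m ++ v) ?_ ?_
    · simp only [eval_append, m1]
      exact isConj_of_eq (by simp [mul_assoc])
    · simp at m2 ⊢; omega
  · rcases l with _ | ⟨s, l⟩
    · exact ⟨1, IsConj.refl _, .inl rfl⟩
    · exact ⟨_, IsConj.refl _, .inr (.inr (.inr ⟨s :: l, by simp, rfl, le_rfl⟩))⟩
  · rcases List.eq_nil_or_concat l with rfl | ⟨l, s, rfl⟩
    · exact ⟨gA, isConj_of_eq (by simp [altWord, letterVal]), .inr (.inl rfl)⟩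
    · refine reduce (altWord l ++ [some s]) ?_ ?_
      · rw [eval_cons]
        convert isConj_mul_comm _ _ using 1
        simp [altWord_append, altWord, letterVal, mul_assoc]
      · simp [altWord_append, altWord, letterWeight]; omega
  · rcases l with _ | ⟨s', l⟩
    · exact ⟨s.val, isConj_of_eq (by simp [altWord, letterVal]),
        .inr (.inr (.inl ⟨s, rfl, by simp [altWord, letterWeight]⟩))⟩
    · obtain ⟨m, m1, m2⟩ := exists_merge (some s) (some s') rfl
      refine reduce (m ++ none :: altWord l) ?_ ?_
      · rw [eval_append, eval_append, m1]
        convert isConj_mul_comm _ _ using 1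
        simp [altWord, mul_assoc]
      · simp [altWord] at m2 ⊢; omega
  · refine ⟨eval (altWord (s :: l)), ?_, .inr (.inr (.inr ⟨s :: l, by simp, rfl, ?_⟩))⟩
    · rw [eval_append]
      convert isConj_mul_comm _ _ using 1
      simp [altWord]
    · simp [altWord]; omega

/-- A word for the section at `x` of an alternating word. -/
def secWord (x : Bool) : List Star → List (Option Star)
  | [] => []
  | s :: l => (if (x ^^ l.length.bodd) then s.left else [some s.next]) ++ secWord x l

theorem Star.swp_val (s : Star) : swp s.val = false := by cases s <;> simp [Star.val]

theorem Star.sec_true_val (s : Star) : sec true s.val = eval [some s.next] := by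
  cases s <;> simp [Star.val, Star.next, letterVal]

theorem Star.sec_false_val (s : Star) : sec false s.val = eval s.left := by
  cases s <;> simp [Star.val, Star.left, letterVal]

theorem swp_eval_altWord (l : List Star) : swp (eval (altWord l)) = l.length.bodd := by
  induction l with
  | nil => simp [altWord]
  | cons s l ih => simp [altWord, ih, letterVal, Star.swp_val]

theorem eval_secWord (x : Bool) (l : List Star) : eval (secWord x l) = sec x (eval (altWord l)) := by
  induction l with
  | nil => simp [secWord, altWord]
  | cons s l ih =>
    simp only [secWord, altWord, eval_append, ih, eval_cons, letterVal, sec_mul, swp_mul, swp_gA, sec_gA,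
      swp_eval_altWord, one_mul]
    congr 1
    cases x <;> cases l.length.bodd <;> simp [Star.sec_true_val, Star.sec_false_val]

/-- Each syllable contributes `s.left` to one section and `s.next` to the other; for each of `b`,
`c`, `d` the two weights add up to one less than that of `sa`. -/
theorem wt_secWord (x : Bool) (l : List Star) :
    wt (secWord (!x) l) + wt (secWord x l) + l.length = wt (altWord l) := by
  induction l with
  | nil => rfl
  | cons s l ih =>
    simp only [secWord, altWord, wt_append, wt_cons, List.length_cons]
    cases x <;> cases l.length.bodd <;> cases s <;>
      simp [Star.left, Star.next, letterWeight, Star.weight] at ih ⊢ <;> omega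

/-- The parity alternates along the word, so one of two consecutive syllables contributes `next`,
whose weight is at least 3. -/
theorem three_le_wt_secWord (x : Bool) (s s' : Star) (l : List Star) :
    3 ≤ wt (secWord x (s :: s' :: l)) := by
  simp only [secWord, wt_append, List.length_cons, Nat.bodd_succ]
  have : ∀ s : Star, 3 ≤ wt [some s.next] := by
    intro s; cases s <;> simp [Star.next, letterWeight, Star.weight]
  have h1 := this s
  have h2 := this s'
  cases x <;> cases l.length.bodd <;> simp [-wt_cons] <;> omega

theorem NormalForm.of_swp_true {g : Grig} {n : ℕ} (h : NormalForm g n) (hg : swp g = true) (i : Bool) :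
    sec (!i) g * sec i g = 1 ∨ ∃ w, eval w = sec (!i) g * sec i g ∧ wt w < n := by
  rcases h with rfl | rfl | ⟨s, rfl, h⟩ | ⟨l, h0, rfl, h⟩
  · simp at hg
  · exact .inl (by simp)
  · simp [s.swp_val] at hg
  · refine .inr ⟨secWord (!i) l ++ secWord i l, by simp [eval_secWord], ?_⟩
    have := wt_secWord i l
    have := List.length_pos_of_ne_nil h0
    rw [wt_append]; omega

theorem NormalForm.of_swp_false {g : Grig} {n : ℕ} (h : NormalForm g n) (hg : swp g = false) :
    g = 1 ∨ (∃ s : Star, g = s.val ∧ s.weight ≤ n) ∨ ∀ i, ∃ w, eval w = sec i g ∧ wt w + 5 ≤ n := by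
  rcases h with rfl | rfl | h | ⟨l, h0, rfl, h⟩
  · exact .inl rfl
  · simp at hg
  · exact .inr (.inl h)
  · refine .inr (.inr fun i ↦ ⟨secWord i l, eval_secWord i l, ?_⟩)
    rw [swp_eval_altWord] at hg
    match l, h0, hg with
    | [s], _, hg => simp at hg
    | s :: s' :: l, _, _ =>
      -- The loss of 5 is at least 3 for the other section plus 2 for the length.
      have := three_le_wt_secWord (!i) s s' l
      have := wt_secWord i (s :: s' :: l)
      simp only [List.length_cons] at this
      omega

/-- A section of a generator may be heavier, the worst case being `d` with section `b`. A gain of 2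
is still outweighed by the loss of 5 on the long word it is compared with. -/
theorem Star.exists_word_sec (s : Star) (i : Bool) : ∃ w, eval w = sec i s.val ∧ wt w ≤ s.weight + 2 := by
  cases i
  · exact ⟨s.left, s.sec_false_val.symm, by cases s <;> simp [Star.left, Star.weight, letterWeight]⟩
  · exact ⟨_, s.sec_true_val.symm, by cases s <;> simp [Star.next, Star.weight, letterWeight]⟩

theorem Star.conjDetected (s s' : Star) : ConjDetected K s.val s'.val := by
  cases s <;> cases s' <;> simp only [Star.val]
  · exact conjDetected_gB
  · exact conjDetected_of_chi_ne (by simp)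
  · exact conjDetected_of_chi_ne (by simp)
  · exact conjDetected_of_chi_ne (by simp)
  · exact conjDetected_gC
  · exact conjDetected_of_chi_ne (by simp)
  · exact conjDetected_of_chi_ne (by simp)
  · exact conjDetected_of_chi_ne (by simp)
  · exact conjDetected_gD

/-- Induction on the total weight of two words: up to conjugacy both are in normal form, and passing
to sections decreases the total unless both are among `b`, `c`, `d` or one is trivial. The descent
yields detection for `Kn 1`, which is weakened to `K`. -/
theorem conjDetected_K (g x : Grig) : ConjDetected K g x := by
  obtain ⟨w, rfl⟩ := exists_eval_eq g
  obtain ⟨w', rfl⟩ := exists_eval_eq x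
  induction hn : wt w + wt w' using Nat.strong_induction_on generalizing w w' with
  | _ n ih =>
  subst hn
  obtain ⟨g, hg, hg'⟩ := exists_normalForm w
  obtain ⟨x, hx, hx'⟩ := exists_normalForm w'
  refine ConjDetected.of_conj hg hx ?_
  by_cases hs : swp g = swp x
  swap
  · exact fun _ hv ↦ (hs hv.swp_eq).elim
  cases hs' : swp g
  · rcases hg'.of_swp_false hs' with rfl | ⟨s, rfl, h1⟩ | h1
    · exact .one_left _ _
    · rcases hx'.of_swp_false (hs ▸ hs') with rfl | ⟨s', rfl, h2⟩ | h2
      · exact .one_right _ _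
      · exact s.conjDetected s'
      · refine conjDetected_K_of_Kn_one (conjDetected_of_sec hs' fun i j ↦ ?_)
        obtain ⟨v, e, hv⟩ := s.exists_word_sec i
        obtain ⟨v', e', hv'⟩ := h2 j
        rw [← e, ← e']
        exact ih _ (by omega) v v' rfl
    · rcases hx'.of_swp_false (hs ▸ hs') with rfl | ⟨s', rfl, h2⟩ | h2
      · exact .one_right _ _
      · refine conjDetected_K_of_Kn_one (conjDetected_of_sec hs' fun i j ↦ ?_)
        obtain ⟨v, e, hv⟩ := h1 i
        obtain ⟨v', e', hv'⟩ := s'.exists_word_sec j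
        rw [← e, ← e']
        exact ih _ (by omega) v v' rfl
      · refine conjDetected_K_of_Kn_one (conjDetected_of_sec hs' fun i j ↦ ?_)
        obtain ⟨v, e, hv⟩ := h1 i
        obtain ⟨v', e', hv'⟩ := h2 j
        rw [← e, ← e']
        exact ih _ (by omega) v v' rfl
  · refine conjDetected_K_of_Kn_one (conjDetected_of_sec_mul_sec hs' fun i ↦ ?_)
    rcases hg'.of_swp_true hs' false with e | ⟨v, e, hv⟩
    · rw [Bool.not_false] at e
      rw [e]; exact .one_left _ _
    rcases hx'.of_swp_true (hs ▸ hs') i with e' | ⟨v', e', hv'⟩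
    · rw [e']; exact .one_right _ _
    rw [Bool.not_false] at e
    rw [← e, ← e']
    exact ih _ (by omega) v v' rfl

theorem conjDetected_Kn (n : ℕ) (g x : Grig) : ConjDetected (Kn n) g x := by
  induction n generalizing g x with
  | zero => exact conjDetected_K g x
  | succ n ih =>
    cases hg : swp g
    · exact conjDetected_of_sec hg fun _ _ ↦ ih _ _
    · exact conjDetected_of_sec_mul_sec hg fun _ ↦ ih _ _

/-! ### Torsion -/

theorem isOfFinOrder_of_sec {g : Grig} (hg : swp g = false) (h : ∀ i, IsOfFinOrder (sec i g)) :
    IsOfFinOrder g := by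
  have key : ∀ m : ℕ, swp (g ^ m) = false ∧ ∀ x, sec x (g ^ m) = sec x g ^ m := by
    intro m
    induction m with
    | zero => simp
    | succ m ih => simp [pow_succ, ih, hg]
  obtain ⟨m, m0, hm⟩ := isOfFinOrder_iff_pow_eq_one.1 (h false)
  obtain ⟨n, n0, hn⟩ := isOfFinOrder_iff_pow_eq_one.1 (h true)
  refine isOfFinOrder_iff_pow_eq_one.2 ⟨m * n, Nat.mul_pos m0 n0, sec_ext ?_ fun x ↦ ?_⟩
  · rw [(key _).1, swp_one]
  · rw [(key _).2, sec_one]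
    cases x
    · rw [pow_mul, hm, one_pow]
    · rw [mul_comm, pow_mul, hn, one_pow]

theorem isOfFinOrder_of_isConj {g h : Grig} (hgh : IsConj g h) (hh : IsOfFinOrder h) : IsOfFinOrder g := by
  obtain ⟨u, rfl⟩ := isConj_iff.1 hgh
  obtain ⟨n, n0, hn⟩ := isOfFinOrder_iff_pow_eq_one.1 hh
  rw [conj_pow] at hn
  exact isOfFinOrder_iff_pow_eq_one.2 ⟨n, n0, by simpa using hn⟩

/-- The same descent on weight: sections of `g`, or of `g²` when `g` swaps, have smaller weight up
to conjugacy, the base case being involutions. -/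
theorem isOfFinOrder_grig (g : Grig) : IsOfFinOrder g := by
  have of_sq : ∀ g : Grig, IsOfFinOrder (g * g) → IsOfFinOrder g := by
    intro g hg
    rw [← pow_two] at hg
    exact hg.of_pow two_ne_zero
  obtain ⟨w, rfl⟩ := exists_eval_eq g
  induction hn : wt w using Nat.strong_induction_on generalizing w with
  | _ n ih =>
  subst hn
  obtain ⟨g, hg, hg'⟩ := exists_normalForm w
  refine isOfFinOrder_of_isConj hg ?_
  cases hs : swp g
  · rcases hg'.of_swp_false hs with rfl | ⟨s, rfl, -⟩ | h
    · exact IsOfFinOrder.one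
    · exact of_sq _ (by cases s <;> simp [Star.val])
    · refine isOfFinOrder_of_sec hs fun i ↦ ?_
      obtain ⟨v, e, hv⟩ := h i
      rw [← e]
      exact ih _ (by omega) v rfl
  · refine of_sq _ (isOfFinOrder_of_sec (by simp) fun i ↦ ?_)
    rw [sec_mul, hs, Bool.xor_true]
    rcases hg'.of_swp_true hs i with e | ⟨v, e, hv⟩
    · rw [e]; exact IsOfFinOrder.one
    · rw [← e]; exact ih _ hv v rfl

/-! ### The congruence subgroup property -/

/-- `y` acts as `k` on the subtree at `v` and trivially elsewhere. -/
def IsAt : List Bool → Grig → Grig → Prop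
  | [], k, y => y = k
  | x :: v, k, y => swp y = false ∧ IsAt v k (sec x y) ∧ sec (!x) y = 1

theorem IsAt.unique {v : List Bool} {k y z : Grig} (hy : IsAt v k y) (hz : IsAt v k z) : y = z := by
  induction v generalizing y z with
  | nil => exact hy.trans hz.symm
  | cons x v ih =>
    refine sec_ext (hy.1.trans hz.1.symm) fun i ↦ ?_
    rcases Bool.eq_or_eq_not i x with rfl | rfl
    · exact ih hy.2.1 hz.2.1
    · exact hy.2.2.trans hz.2.2.symm

theorem IsAt.mul {v : List Bool} {k l y z : Grig} (hy : IsAt v k y) (hz : IsAt v l z) :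
    IsAt v (k * l) (y * z) := by
  induction v generalizing y z with
  | nil => exact congrArg₂ _ hy hz
  | cons x v ih =>
    refine ⟨by simp [hy.1, hz.1], ?_, by simp [hz.1, hy.2.2, hz.2.2]⟩
    rw [sec_mul, hz.1, Bool.xor_false]
    exact ih hy.2.1 hz.2.1

theorem IsAt.inv {v : List Bool} {k y : Grig} (hy : IsAt v k y) : IsAt v k⁻¹ y⁻¹ := by
  induction v generalizing y with
  | nil => exact congrArg _ hy
  | cons x v ih =>
    refine ⟨by simp [hy.1], ?_, by simp [hy.1, hy.2.2]⟩
    rw [sec_inv, hy.1, Bool.xor_false]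
    exact ih hy.2.1

theorem IsAt.append {v w : List Bool} {k y z : Grig} (hy : IsAt w k y) (hz : IsAt v y z) :
    IsAt (v ++ w) k z := by
  induction v generalizing z with
  | nil => rwa [show z = y from hz]
  | cons x v ih => exact ⟨hz.1, ih hz.2.1, hz.2.2⟩

theorem exists_isAt {k : Grig} (hk : k ∈ K) (v : List Bool) : ∃ y ∈ K, IsAt v k y := by
  induction v with
  | nil => exact ⟨k, hk, rfl⟩
  | cons x v ih =>
    obtain ⟨y, yK, hy⟩ := ih
    obtain ⟨z, zK, z1, z2, z3⟩ := K_le_corner x yK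
    exact ⟨z, zK, z1, z2 ▸ hy, z3⟩

theorem IsAt.comm {v w : List Bool} {k l y z : Grig} (hvw : v.length = w.length) (hne : v ≠ w)
    (hy : IsAt v k y) (hz : IsAt w l z) : y * z = z * y := by
  induction v generalizing w y z with
  | nil => exact (hne (List.length_eq_zero_iff.1 hvw.symm).symm).elim
  | cons x v ih =>
    rcases w with _ | ⟨x', w⟩
    · simp at hvw
    refine sec_ext (by simp [Bool.xor_comm]) fun i ↦ ?_
    rw [sec_mul, sec_mul, hy.1, hz.1, Bool.xor_false]
    rcases Bool.eq_or_eq_not x' x with rfl | rfl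
    · rcases Bool.eq_or_eq_not i x' with rfl | rfl
      · exact ih (by simpa using hvw) (fun h ↦ hne (by rw [h])) hy.2.1 hz.2.1
      · rw [hy.2.2, hz.2.2]
    · rcases Bool.eq_or_eq_not i x with rfl | rfl
      · have := hz.2.2
        rw [Bool.not_not] at this
        rw [this, one_mul, mul_one]
      · rw [hy.2.2, one_mul, mul_one]

/-- The section at a vertex. -/
noncomputable def secAt : List Bool → Grig → Grig
  | [], g => g
  | x :: v, g => secAt v (sec x g)

theorem IsAt.conj {v : List Bool} {k y : Grig} (hy : IsAt v k y) (g : Grig) :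
    IsAt (act g v) (secAt v g * k * (secAt v g)⁻¹) (g * y * g⁻¹) := by
  induction v generalizing y g with
  | nil => rw [act_nil, show y = k from hy]; rfl
  | cons x v ih =>
    rw [act_cons]
    refine ⟨by rw [swp_conj, hy.1], ?_, ?_⟩
    · rw [sec_conj_of_swp_eq_false g hy.1, Bool.xor_assoc, Bool.xor_self, Bool.xor_false]
      exact ih hy.2.1 _
    · rw [sec_conj_of_swp_eq_false g hy.1, show ((!(x ^^ swp g)) ^^ swp g) = !x by
        cases x <;> cases swp g <;> rfl, hy.2.2]
      simp

theorem act_length (g : Grig) (v : List Bool) : (act g v).length = v.length := by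
  induction v generalizing g with
  | nil => rw [act_nil]
  | cons x v ih => rw [act_cons, List.length_cons, ih, List.length_cons]

theorem exists_act_eq_secAt_eq {v w : List Bool} (h : v.length = w.length) (s : Grig) :
    ∃ g, act g v = w ∧ secAt v g = s := by
  induction v generalizing w with
  | nil =>
    refine ⟨s, ?_, rfl⟩
    rw [act_nil, List.length_eq_zero_iff.1 h.symm]
  | cons x v ih =>
    rcases w with _ | ⟨x', w⟩
    · simp at h
    obtain ⟨g, g1, g2⟩ := ih (w := w) (by simpa using h)
    obtain ⟨y, y1, rfl⟩ := exists_sec_eq x g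
    rcases Bool.eq_or_eq_not x' x with rfl | rfl
    · exact ⟨y, by rw [act_cons, y1, g1, Bool.xor_false], g2⟩
    · refine ⟨gA * y, ?_, ?_⟩
      · rw [act_cons, swp_mul, y1, sec_mul, sec_gA, one_mul, g1]; simp
      · rw [secAt, sec_mul, sec_gA, one_mul, g2]

theorem Kn_le_of_isAt {n : ℕ} {N : Subgroup Grig}
    (h : ∀ v : List Bool, v.length = n → ∀ k ∈ K, ∀ y, IsAt v k y → y ∈ N) : Kn n ≤ N := by
  induction n generalizing N with
  | zero => exact fun k hk ↦ h [] rfl k hk k rfl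
  | succ n ih =>
    have key : ∀ x, Kn n ≤ corner x N := by
      refine fun x ↦ ih fun v hv k hk y hy ↦ ?_
      obtain ⟨z, -, hz⟩ := exists_isAt hk (x :: v)
      exact ⟨z, h _ (by simp [hv]) k hk z hz, hz.1, hz.2.1.unique hy, hz.2.2⟩
    rw [Kn_succ]
    intro g hg
    obtain ⟨y, yN, y1, y2, y3⟩ := key false (hg.2 false)
    obtain ⟨z, zN, z1, z2, z3⟩ := key true (hg.2 true)
    have : g = y * z := by
      refine sec_ext (by rw [hg.1, swp_mul, y1, z1]; rfl) fun x ↦ ?_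
      rw [sec_mul, z1, Bool.xor_false]
      simp only [Bool.not_false, Bool.not_true] at y3 z3
      cases x
      · rw [y2, z3, mul_one]
      · rw [y3, z2, one_mul]
    exact this ▸ mul_mem yN zN

theorem Kn_le_of_isAt_tt {v : List Bool} {N : Subgroup Grig} [hN : N.Normal] {s y : Grig} (hyN : y ∈ N)
    (hy : IsAt v (s * tt * s⁻¹) y) : Kn v.length ≤ N := by
  -- Those `k` all of whose conjugates, placed at any vertex of this level, lie in `N`. This is a
  -- normal subgroup; it contains `abab` because some group element moves `v` to any vertex of the
  -- level with any prescribed section. Hence it contains `K`.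
  let M : Subgroup Grig :=
    { carrier := {k | k ∈ K ∧ ∀ w : List Bool, w.length = v.length → ∀ r z, IsAt w (r * k * r⁻¹) z → z ∈ N}
      one_mem' := by
        refine ⟨one_mem _, fun w _ r z hz ↦ ?_⟩
        have h1 : IsAt w 1 (z * z⁻¹) := by simpa using hz.mul hz.inv
        rw [hz.unique (by simpa using h1)]
        simp
      mul_mem' := by
        rintro k l ⟨hk, hk'⟩ ⟨hl, hl'⟩
        refine ⟨mul_mem hk hl, fun w hw r z hz ↦ ?_⟩
        obtain ⟨p, -, hp⟩ := exists_isAt (K_normal.conj_mem _ hk r) w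
        obtain ⟨q, -, hq⟩ := exists_isAt (K_normal.conj_mem _ hl r) w
        have := hp.mul hq
        rw [hz.unique (z := p * q) (by convert this using 1; group)]
        exact mul_mem (hk' w hw r p hp) (hl' w hw r q hq)
      inv_mem' := by
        rintro k ⟨hk, hk'⟩
        refine ⟨inv_mem hk, fun w hw r z hz ↦ ?_⟩
        refine inv_mem_iff.1 (hk' w hw r z⁻¹ ?_)
        convert hz.inv using 1; group }
  have hM : M.Normal := ⟨fun k hk u ↦ ⟨K_normal.conj_mem _ hk.1 _, fun w hw r z hz ↦
    hk.2 w hw (r * u) z (by convert hz using 1; group)⟩⟩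
  have htt : tt ∈ M := by
    refine ⟨mem_K_tt, fun w hw r z hz ↦ ?_⟩
    obtain ⟨g, rfl, g2⟩ := exists_act_eq_secAt_eq hw.symm (r * s⁻¹)
    have := hy.conj g
    rw [hz.unique (z := g * y * g⁻¹) (by convert this using 1; rw [g2]; group)]
    exact hN.conj_mem y hyN g
  have hKM : K ≤ M := by
    rw [K_eq_normalClosure]
    exact Subgroup.normalClosure_le_normal (Set.singleton_subset_iff.2 htt)
  exact Kn_le_of_isAt fun w hw k hk z hz ↦ (hKM hk).2 w hw 1 z (by simpa using hz)

/-- A commutator of two elements of `K` that is a conjugate of `abab` at a vertex. -/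
theorem exists_isAt_commutator : ∃ k ∈ K, ∃ l ∈ K, ∃ w s, IsAt w (s * tt * s⁻¹) (k * l * k⁻¹ * l⁻¹) := by
  obtain ⟨l, hl, hl'⟩ := exists_isAt mem_K_tt [false, false, false, true, true]
  -- The power (ab)⁸ fixes the vertex 00011 and has section `d` there. Its commutator with `abab`
  -- placed at 00011 is therefore d(abab)d(abab)⁻¹ at that vertex.
  refine ⟨tt ^ 4, pow_mem mem_K_tt 4, l, hl, [false, false, false, true, true, true], ?_⟩
  have h := hl'.conj (tt ^ 4)
  have e1 : act (tt ^ 4) [false, false, false, true, true] = [false, false, false, true, true] := by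
    simp [act_cons, act_nil, tt, pow_succ]
  have e2 : secAt [false, false, false, true, true] (tt ^ 4) = gD := by
    simp [secAt, tt, pow_succ]
  rw [e1, e2] at h
  -- Since d = (1, b) and abab = (ca, ac), that commutator is trivial at `false` and equals
  -- b(ac)b(ac)⁻¹ = b(abab)b⁻¹ at `true`.
  refine ⟨gB, ?_⟩
  refine IsAt.append (v := [false, false, false, true, true]) (w := [true]) ?_ (h.mul hl'.inv)
  refine ⟨by simp [tt], ?_, by simp [tt, mul_assoc]⟩
  simp [IsAt, tt, mul_assoc]

/-- If `g ∈ N` moves `v`, take `y` and `z` supported at `v`. The commutator [g, y] is y⁻¹ times an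
element supported elsewhere, so [[g, y], z] = [y⁻¹, z] lies in `N`. Choosing `y` and `z` suitably
makes this a conjugate of `abab` at a vertex. -/
theorem exists_Kn_le {N : Subgroup Grig} [hN : N.Normal] (h : N ≠ ⊥) : ∃ n, Kn n ≤ N := by
  obtain ⟨g, hg, hg1⟩ := N.bot_or_exists_ne_one.resolve_left h
  obtain ⟨v, hv⟩ : ∃ v, act g v ≠ v := by
    by_contra! hc
    exact hg1 (act_ext hc)
  obtain ⟨k, hk, l, hl, w, s, hw⟩ := exists_isAt_commutator
  obtain ⟨y, -, hy⟩ := exists_isAt (inv_mem hk) v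
  obtain ⟨z, -, hz⟩ := exists_isAt hl v
  have hc := IsAt.comm (act_length g v) hv (hy.conj g) hz
  have hc' := IsAt.comm (act_length g v) hv (hy.conj g) hy
  have hmem : (g * y * g⁻¹ * y⁻¹) * (z * (g * y * g⁻¹ * y⁻¹)⁻¹ * z⁻¹) ∈ N := by
    have h1 : g * y * g⁻¹ * y⁻¹ ∈ N := by
      convert mul_mem hg (hN.conj_mem _ (inv_mem hg) y) using 1; group
    exact mul_mem h1 (hN.conj_mem _ (inv_mem h1) z)
  have e : (g * y * g⁻¹ * y⁻¹) * (z * (g * y * g⁻¹ * y⁻¹)⁻¹ * z⁻¹) = y⁻¹ * z * y * z⁻¹ := by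
    set q := g * y * g⁻¹
    have c1 : Commute q z := hc
    have c2 : Commute q y := hc'
    have c3 : Commute q (y⁻¹ * z * y * z⁻¹) :=
      ((c2.inv_right.mul_right c1).mul_right c2).mul_right c1.inv_right
    calc q * y⁻¹ * (z * (q * y⁻¹)⁻¹ * z⁻¹) = q * (y⁻¹ * z * y) * (q⁻¹ * z⁻¹) := by group
      _ = q * (y⁻¹ * z * y) * (z⁻¹ * q⁻¹) := by rw [(c1.inv_left.inv_right).eq]
      _ = q * (y⁻¹ * z * y * z⁻¹) * q⁻¹ := by group
      _ = _ := by rw [c3.eq, mul_inv_cancel_right]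
  rw [e] at hmem
  have := ((hy.inv.mul hz).mul hy).mul hz.inv
  rw [inv_inv] at this
  have := IsAt.append hw this
  exact ⟨_, Kn_le_of_isAt_tt hmem this⟩

/-- A proper subgroup, the stabiliser of the first level, maps onto the whole group. -/
theorem infinite_grig : Infinite Grig := by
  refine ⟨fun hfin ↦ ?_⟩
  let f : below ⊤ → Grig := fun g ↦ sec false g
  have hf : Function.Surjective f := fun s ↦ by
    obtain ⟨g, g1, g2⟩ := exists_sec_eq false s
    exact ⟨⟨g, g1, fun _ ↦ trivial⟩, g2⟩
  have h1 := Nat.card_le_card_of_surjective f hf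
  have h2 := Subgroup.eq_top_of_le_card _ h1
  have : gA ∈ below ⊤ := (SetLike.ext_iff.1 h2 gA).2 trivial
  simpa using this.1

theorem exists_Kn_le_of_finite_quotient {N : Subgroup Grig} [N.Normal] [Finite (Grig ⧸ N)] :
    ∃ n, Kn n ≤ N := by
  refine exists_Kn_le ?_
  rintro rfl
  have := infinite_grig
  exact not_finite_iff_infinite.2 this (Finite.of_equiv _ QuotientGroup.quotientBot.toEquiv)

end Grigorchuk

/-! ### A criterion for hereditary conjugacy separability -/

section

variable {p : ℕ} {G : Type*} [Group G]

theorem isCoP_iff {N : Subgroup G} :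
    IsCoP p N ↔ N.Normal ∧ N.FiniteIndex ∧ ∀ g : G, ∃ k : ℕ, g ^ p ^ k ∈ N := by
  constructor
  · rintro ⟨hN, hfin, hp⟩
    refine ⟨hN, Subgroup.finiteIndex_of_finite_quotient, fun g ↦ ?_⟩
    obtain ⟨k, hk⟩ := hp g
    exact ⟨k, (QuotientGroup.eq_one_iff _).1 hk⟩
  · rintro ⟨hN, hfin, hp⟩
    refine ⟨hN, Subgroup.finite_quotient_of_finiteIndex, ?_⟩
    rintro ⟨g⟩
    obtain ⟨k, hk⟩ := hp g
    exact ⟨k, (QuotientGroup.eq_one_iff _).2 hk⟩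

theorem IsCoP.normal {N : Subgroup G} (h : IsCoP p N) : N.Normal := h.1

theorem IsCoP.finite {N : Subgroup G} (h : IsCoP p N) : Finite (G ⧸ N) := h.2.1

theorem isCoP_top : IsCoP p (⊤ : Subgroup G) :=
  isCoP_iff.2 ⟨Subgroup.normal_top, inferInstance, fun _ ↦ ⟨0, trivial⟩⟩

theorem IsCoP.iInf {ι : Type*} [Finite ι] {N : ι → Subgroup G} (h : ∀ i, IsCoP p (N i)) :
    IsCoP p (⨅ i, N i) := by
  simp only [isCoP_iff] at h ⊢
  refine ⟨Subgroup.normal_iInf_normal fun i ↦ (h i).1, Subgroup.finiteIndex_iInf fun i ↦ (h i).2.1,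
    fun g ↦ ?_⟩
  choose k hk using fun i ↦ (h i).2.2 g
  cases nonempty_fintype ι
  refine ⟨∑ i, k i, Subgroup.mem_iInf.2 fun i ↦ ?_⟩
  obtain ⟨m, hm⟩ := Finset.dvd_prod_of_mem (fun i ↦ p ^ k i) (Finset.mem_univ i)
  rw [← Finset.prod_pow_eq_pow_sum, hm, pow_mul]
  exact pow_mem (hk i) m

theorem IsCoP.inf {N M : Subgroup G} (hN : IsCoP p N) (hM : IsCoP p M) : IsCoP p (N ⊓ M) := by
  have : N ⊓ M = ⨅ i : Bool, bif i then N else M := by rw [iInf_bool_eq]; rfl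
  rw [this]
  exact IsCoP.iInf fun i ↦ by cases i <;> assumption

theorem IsCoP.comap {H : Type*} [Group H] {N : Subgroup G} (h : IsCoP p N) (f : H →* G) :
    IsCoP p (N.comap f) := by
  rw [isCoP_iff] at h ⊢
  obtain ⟨h1, h2, h3⟩ := h
  have : (N.comap f).FiniteIndex :=
    ⟨by rw [Subgroup.index_comap]; exact (Subgroup.instFiniteIndex_subgroupOf N f.range).index_ne_zero⟩
  refine ⟨inferInstance, inferInstance, fun g ↦ ?_⟩
  obtain ⟨k, hk⟩ := h3 (f g)
  exact ⟨k, by rwa [Subgroup.mem_comap, map_pow]⟩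

theorem IsCoP.map_mulEquiv {H : Type*} [Group H] {N : Subgroup G} (h : IsCoP p N) (e : G ≃* H) :
    IsCoP p (N.map e.toMonoidHom) := by
  have := h.comap e.symm.toMonoidHom
  rwa [Subgroup.comap_equiv_eq_map_symm'] at this

theorem IsPGroup.isCoP_bot [Finite G] (h : IsPGroup p G) : IsCoP p (⊥ : Subgroup G) :=
  isCoP_iff.2 ⟨inferInstance, inferInstance, fun g ↦
    let ⟨k, hk⟩ := h g; ⟨k, hk⟩⟩

theorem exists_isCoP_of_isOpen {U : Set G} (hU : IsOpen[proPTopology p G] U) :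
    ∀ x ∈ U, ∃ N : Subgroup G, IsCoP p N ∧ ∀ y, x⁻¹ * y ∈ N → y ∈ U := by
  induction hU with
  | basic U hU =>
    obtain ⟨g, N, hN, rfl⟩ := hU
    exact fun x hx ↦ ⟨N, hN, fun y hy ↦ by simpa using mul_mem hx hy⟩
  | univ => exact fun x _ ↦ ⟨⊤, isCoP_top, fun _ _ ↦ trivial⟩
  | inter U V _ _ ihU ihV =>
    rintro x ⟨hxU, hxV⟩
    obtain ⟨N, hN, hN'⟩ := ihU x hxU
    obtain ⟨M, hM, hM'⟩ := ihV x hxV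
    exact ⟨N ⊓ M, hN.inf hM, fun y hy ↦ ⟨hN' y hy.1, hM' y hy.2⟩⟩
  | sUnion S _ ih =>
    rintro x ⟨U, hU, hxU⟩
    obtain ⟨N, hN, hN'⟩ := ih U hU x hxU
    exact ⟨N, hN, fun y hy ↦ ⟨U, hU, hN' y hy⟩⟩

/-- For every co-`p` subgroup `N`, the orbits of `N` acting on `G` by conjugation are closed in the
pro-`p` topology. -/
def HasClosedConjOrbits (p : ℕ) (G : Type*) [Group G] : Prop :=
  ∀ N : Subgroup G, IsCoP p N → ∀ g x : G,
    (∀ L : Subgroup G, IsCoP p L → ∃ n ∈ N, n * g * n⁻¹ * x⁻¹ ∈ L) → ∃ n ∈ N, n * g * n⁻¹ = x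

/-- `X` is a finite union of cosets `M y`, so an `X`-orbit is a finite union of `M`-orbits. If each
is missed modulo some co-`p` subgroup, all are missed modulo the intersection. -/
theorem exists_conj_eq_of_le {M X : Subgroup G} (hM : IsCoP p M) (hMX : M ≤ X) {g x : G}
    (h : ∀ g : G, (∀ L : Subgroup G, IsCoP p L → ∃ n ∈ M, n * g * n⁻¹ * x⁻¹ ∈ L) →
      ∃ n ∈ M, n * g * n⁻¹ = x)
    (hgx : ∀ L : Subgroup G, IsCoP p L → ∃ y ∈ X, y * g * y⁻¹ * x⁻¹ ∈ L) :
    ∃ y ∈ X, y * g * y⁻¹ = x := by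
  have hMn := hM.normal
  have hfin := hM.finite
  by_contra! hc
  have key : ∀ q : G ⧸ M, ∃ L : Subgroup G, IsCoP p L ∧
      ∀ y ∈ X, (y : G ⧸ M) = q → y * g * y⁻¹ * x⁻¹ ∉ L := by
    intro q
    by_cases hq : ∃ y ∈ X, (y : G ⧸ M) = q
    swap
    · exact ⟨⊤, isCoP_top, fun y hy hy' ↦ (hq ⟨y, hy, hy'⟩).elim⟩
    obtain ⟨y, hy, rfl⟩ := hq
    have := mt (h (y * g * y⁻¹)) (by
      rintro ⟨n, hn, e⟩
      refine hc (n * y) (mul_mem (hMX hn) hy) ?_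
      rw [← e]; group)
    push Not at this
    obtain ⟨L, hL, hL'⟩ := this
    refine ⟨L, hL, fun z _ hz ↦ ?_⟩
    have hn : z * y⁻¹ ∈ M := by
      have := hMn.conj_mem _ (QuotientGroup.eq.1 hz.symm) y
      simpa using this
    convert hL' _ hn using 1
    group
  choose L hL hL' using key
  obtain ⟨n, hn, hn'⟩ := hgx _ (IsCoP.iInf hL)
  exact hL' n n hn rfl (Subgroup.mem_iInf.1 hn' n)

/-- A class of `H` is an orbit of its image in `G`, and co-`p` subgroups of `G` pull back to co-`p`
subgroups of `H`. The injection `f` treats `G` and its open subgroups alike. -/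
theorem HasClosedConjOrbits.isPConjSeparable (h : HasClosedConjOrbits p G) {H : Type*} [Group H]
    {f : H →* G} (hf : Function.Injective f) {N : Subgroup G} (hN : IsCoP p N) (hNf : N ≤ f.range) :
    IsPConjSeparable p H := by
  intro g
  let := proPTopology p H
  rw [← isOpen_compl_iff, isOpen_iff_forall_mem_open]
  intro x hx
  have := mt (exists_conj_eq_of_le hN hNf (g := f g) (x := f x) fun g ↦ h N hN g _) (by
    rintro ⟨_, ⟨y, rfl⟩, e⟩
    exact hx (isConj_iff.2 ⟨y, hf (by simpa using e)⟩))
  push Not at this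
  obtain ⟨L, hL, hL'⟩ := this
  have hco := hL.comap f
  refine ⟨{y | x⁻¹ * y ∈ L.comap f}, fun y hy hgy ↦ ?_,
    TopologicalSpace.isOpen_generateFrom_of_mem ⟨x, _, hco, rfl⟩, by simp [one_mem]⟩
  obtain ⟨z, rfl⟩ := isConj_iff.1 hgy
  have := hco.normal.conj_mem _ hy x
  rw [mul_inv_cancel_left] at this
  exact hL' (f z) ⟨z, rfl⟩ (by simpa using this)

theorem HasClosedConjOrbits.isPHereditarilyConjSeparable (h : HasClosedConjOrbits p G) :
    IsPHereditarilyConjSeparable p G := by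
  refine ⟨h.isPConjSeparable (f := MonoidHom.id G) Function.injective_id isCoP_top
    fun g _ ↦ ⟨g, rfl⟩, fun H hH ↦ ?_⟩
  obtain ⟨N, hN, hNH⟩ := exists_isCoP_of_isOpen hH 1 (one_mem H)
  refine h.isPConjSeparable H.subtype_injective hN fun g hg ↦ ?_
  rw [Subgroup.range_subtype]
  exact hNH g (by simpa using hg)

theorem HasClosedConjOrbits.of_mulEquiv {H : Type*} [Group H] (e : G ≃* H)
    (h : HasClosedConjOrbits p H) : HasClosedConjOrbits p G := by
  intro N hN g x hgx
  obtain ⟨n, hn, hn'⟩ := h _ (hN.map_mulEquiv e) (e g) (e x) fun L hL ↦ by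
    obtain ⟨n, hn, hn'⟩ := hgx _ (hL.comap e.toMonoidHom)
    exact ⟨e n, ⟨n, hn, rfl⟩, by simpa using hn'⟩
  obtain ⟨n, hn, rfl⟩ := hn
  refine ⟨n, hn, e.injective ?_⟩
  rwa [map_mul, map_mul, map_inv]

/-- It suffices to consider arbitrarily small co-`p` subgroups. -/
theorem HasClosedConjOrbits.of_basis (h : ∀ N : Subgroup G, IsCoP p N → ∃ M ≤ N, IsCoP p M ∧
    ∀ g x : G, (∀ L : Subgroup G, IsCoP p L → ∃ n ∈ M, n * g * n⁻¹ * x⁻¹ ∈ L) →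
      ∃ n ∈ M, n * g * n⁻¹ = x) : HasClosedConjOrbits p G := by
  intro N hN g x hgx
  obtain ⟨M, hMN, hM, hM'⟩ := h N hN
  exact exists_conj_eq_of_le hM hMN (fun g ↦ hM' g x) hgx

end

-- Closed orbits in the Grigorchuk group

theorem Grigorchuk.hasClosedConjOrbits : HasClosedConjOrbits 2 grigorchukGroup := by
  intro N hN g x h
  have := hN.normal
  have := hN.finite
  obtain ⟨n, hn⟩ := Grigorchuk.exists_Kn_le_of_finite_quotient (N := N)
  obtain ⟨u, hu, hux⟩ := (Grigorchuk.conjDetected_Kn n g x).mono hn 1 fun m ↦ by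
    obtain ⟨u, hu, hu'⟩ := h _ (Grigorchuk.isCoP_St m)
    exact ⟨u, by simpa using hu, hu'⟩
  exact ⟨u, by simpa using hu, hux⟩

/-! ### Finite cyclic groups acting on group rings -/

section GroupRing

variable (R : Type*) [CommRing R] {C : Type*} [Group C]

theorem MonoidAlgebra.coeff_of_mul (b : C) (f : MonoidAlgebra R C) (x : C) :
    (MonoidAlgebra.of R C b * f).coeff x = f.coeff (b⁻¹ * x) := by
  rw [MonoidAlgebra.of_apply,
    MonoidAlgebra.coeff_single_mul_eq_mul_coeff (m₂ := b⁻¹ * x) (H := fun m _ ↦ eq_inv_mul_iff_mul_eq.symm),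
    one_mul]

/-- The sum of the powers of `γ` in the group ring. -/
noncomputable def traceElt (γ : C) : MonoidAlgebra R C :=
  ∑ i ∈ Finset.range (orderOf γ), MonoidAlgebra.of R C γ ^ i

variable {R}

theorem traceElt_mul_one_sub (γ : C) : traceElt R γ * (1 - MonoidAlgebra.of R C γ) = 0 := by
  have := geom_sum_mul (MonoidAlgebra.of R C γ) (orderOf γ)
  rw [← map_pow, pow_orderOf_eq_one, map_one, sub_self] at this
  rw [← neg_sub, mul_neg, traceElt, this, neg_zero]

theorem one_sub_mul_traceElt (γ : C) : (1 - MonoidAlgebra.of R C γ) * traceElt R γ = 0 := by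
  have := mul_geom_sum (MonoidAlgebra.of R C γ) (orderOf γ)
  rw [← map_pow, pow_orderOf_eq_one, map_one, sub_self] at this
  rw [← neg_sub, neg_mul, traceElt, this, neg_zero]

theorem exists_transversal {γ : C} (hγ : IsOfFinOrder γ) : ∃ S : Set C, ∀ x : C,
    ∃ i ∈ Finset.range (orderOf γ), (γ ^ i)⁻¹ * x ∈ S ∧
      ∀ j ∈ Finset.range (orderOf γ), (γ ^ j)⁻¹ * x ∈ S → j = i := by
  classical
  let s := QuotientGroup.rightRel (Subgroup.zpowers γ)
  refine ⟨{x | (Quotient.mk s x).out = x}, fun x ↦ ?_⟩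
  have hout : x * (Quotient.mk s x).out⁻¹ ∈ Subgroup.zpowers γ :=
    QuotientGroup.rightRel_apply.1 (Quotient.exact (Quotient.out_eq (Quotient.mk s x)))
  rw [hγ.mem_zpowers_iff_mem_range_orderOf, Finset.mem_image] at hout
  obtain ⟨i, hi, e⟩ := hout
  have e' : (γ ^ i)⁻¹ * x = (Quotient.mk s x).out := by rw [e]; group
  refine ⟨i, hi, ?_, fun j hj hS ↦ ?_⟩
  · rw [e', Set.mem_ofPred_eq, Quotient.out_eq]
  · have h1 : Quotient.mk s ((γ ^ j)⁻¹ * x) = Quotient.mk s x := by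
      refine Quotient.sound (QuotientGroup.rightRel_apply.2 ?_)
      have : x * ((γ ^ j)⁻¹ * x)⁻¹ = γ ^ j := by group
      rw [this]
      exact Subgroup.npow_mem_zpowers γ j
    rw [Set.mem_ofPred_eq, h1, ← e', mul_left_inj, inv_inj] at hS
    exact (pow_injOn_Iio_orderOf (by simpa using hi) (by simpa using hj) hS).symm

/-- Freeness over the cyclic group: `P` restricts the support to a transversal of the cosets of
`⟨γ⟩`, and the translates of the transversal partition `C`. -/
theorem exists_addMonoidHom_sum_eq {γ : C} (hγ : IsOfFinOrder γ) :
    ∃ P : MonoidAlgebra R C →+ MonoidAlgebra R C, ∀ f, ∑ i ∈ Finset.range (orderOf γ),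
      MonoidAlgebra.of R C γ ^ i * P (MonoidAlgebra.of R C γ⁻¹ ^ i * f) = f := by
  classical
  obtain ⟨S, hS⟩ := exists_transversal hγ
  let P : MonoidAlgebra R C →+ MonoidAlgebra R C :=
    MonoidAlgebra.coeffAddEquiv.symm.toAddMonoidHom.comp
      ((Finsupp.filterAddHom (· ∈ S)).comp MonoidAlgebra.coeffAddEquiv.toAddMonoidHom)
  have hP : ∀ f x, (P f).coeff x = if x ∈ S then f.coeff x else 0 := fun f x ↦ by
    simp only [P, AddMonoidHom.comp_apply]
    exact Finsupp.filter_apply _ _ _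
  refine ⟨P, fun f ↦ MonoidAlgebra.ext (Finsupp.ext fun x ↦ ?_)⟩
  obtain ⟨i, hi, hi', huniq⟩ := hS x
  rw [MonoidAlgebra.coeff_sum, Finsupp.finsetSum_apply, Finset.sum_eq_single_of_mem i hi]
  · rw [← map_pow, ← map_pow, MonoidAlgebra.coeff_of_mul, hP, if_pos hi', MonoidAlgebra.coeff_of_mul]
    simp
  · intro j hj hji
    rw [← map_pow, ← map_pow, MonoidAlgebra.coeff_of_mul, hP, if_neg fun h ↦ hji (huniq j hj h)]

theorem exists_eq_traceElt_mul {γ : C} (hγ : IsOfFinOrder γ) {f : MonoidAlgebra R C}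
    (hf : (1 - MonoidAlgebra.of R C γ) * f = 0) : ∃ e, f = traceElt R γ * e := by
  obtain ⟨P, hP⟩ := exists_addMonoidHom_sum_eq (R := R) hγ
  have h1 : MonoidAlgebra.of R C γ⁻¹ * f = f := by
    rw [sub_mul, one_mul, sub_eq_zero] at hf
    conv_lhs => rw [hf, ← mul_assoc, ← map_mul, inv_mul_cancel, map_one, one_mul]
  have h2 : ∀ i : ℕ, MonoidAlgebra.of R C γ⁻¹ ^ i * f = f := by
    intro i
    induction i with
    | zero => simp
    | succ i ih => rw [pow_succ, mul_assoc, h1, ih]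
  refine ⟨P f, ?_⟩
  conv_lhs => rw [← hP f]
  simp_rw [h2]
  rw [← Finset.sum_mul, traceElt]

/-- Vanishing trace lets one subtract the sum of the P(γ⁻ⁱ f), which is zero, from f = ∑ γⁱ P(γ⁻ⁱ
f). Each resulting factor γⁱ - 1 is divisible by 1 - γ. -/
theorem exists_eq_one_sub_mul {γ : C} (hγ : IsOfFinOrder γ) {f : MonoidAlgebra R C}
    (hf : traceElt R γ * f = 0) : ∃ e, f = (1 - MonoidAlgebra.of R C γ) * e := by
  obtain ⟨P, hP⟩ := exists_addMonoidHom_sum_eq (R := R) hγ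
  have h0 : ∑ i ∈ Finset.range (orderOf γ), MonoidAlgebra.of R C γ⁻¹ ^ i * f = 0 := by
    have h := congrArg (MonoidAlgebra.of R C γ⁻¹ ^ (orderOf γ - 1) * ·) hf
    simp only [mul_zero] at h
    -- Multiplying by γ to the power 1 - `orderOf γ` and reversing the sum turns positive powers
    -- into inverse ones.
    rw [← h, traceElt, ← Finset.sum_range_reflect (fun i ↦ MonoidAlgebra.of R C γ ^ i), Finset.sum_mul, Finset.mul_sum]
    refine Finset.sum_congr rfl fun i hi ↦ ?_
    have hi := Finset.mem_range.1 hi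
    rw [← mul_assoc, ← map_pow, ← map_pow, ← map_pow, ← map_mul]
    congr 2
    rw [inv_pow, inv_pow, eq_inv_mul_iff_mul_eq, mul_inv_eq_iff_eq_mul, ← pow_add]
    congr 1
    omega
  have h1 : ∑ i ∈ Finset.range (orderOf γ), P (MonoidAlgebra.of R C γ⁻¹ ^ i * f) = 0 := by
    rw [← map_sum, h0, map_zero]
  refine ⟨∑ i ∈ Finset.range (orderOf γ), -((∑ j ∈ Finset.range i, MonoidAlgebra.of R C γ ^ j) *
    P (MonoidAlgebra.of R C γ⁻¹ ^ i * f)), ?_⟩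
  conv_lhs => rw [← hP f, ← sub_zero (Finset.sum _ _), ← h1, ← Finset.sum_sub_distrib]
  rw [Finset.mul_sum]
  refine Finset.sum_congr rfl fun i _ ↦ ?_
  rw [mul_neg, ← mul_assoc, ← neg_mul, ← neg_mul, neg_sub, mul_geom_sum, sub_mul, one_mul]

end GroupRing

/-! ### Wreath products as semidirect products with a group ring -/

/-- The semidirect product of the additive group of the group ring of `B` and of `B`. -/
@[ext]
structure Lamp (R B : Type*) [CommRing R] [Group B] where
  fst : MonoidAlgebra R B
  snd : B

namespace Lamp

section

variable {R B : Type*} [CommRing R] [Group B]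

noncomputable instance : Mul (Lamp R B) where
  mul x y := ⟨x.fst + MonoidAlgebra.of R B x.snd * y.fst, x.snd * y.snd⟩

noncomputable instance : One (Lamp R B) where
  one := ⟨0, 1⟩

noncomputable instance : Inv (Lamp R B) where
  inv x := ⟨-(MonoidAlgebra.of R B x.snd⁻¹ * x.fst), x.snd⁻¹⟩

@[simp] theorem mul_fst (x y : Lamp R B) :
    (x * y).fst = x.fst + MonoidAlgebra.of R B x.snd * y.fst := rfl
@[simp] theorem mul_snd (x y : Lamp R B) : (x * y).snd = x.snd * y.snd := rfl
@[simp] theorem one_fst : (1 : Lamp R B).fst = 0 := rfl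
@[simp] theorem one_snd : (1 : Lamp R B).snd = 1 := rfl
@[simp] theorem inv_fst (x : Lamp R B) :
    x⁻¹.fst = -(MonoidAlgebra.of R B x.snd⁻¹ * x.fst) := rfl
@[simp] theorem inv_snd (x : Lamp R B) : x⁻¹.snd = x.snd⁻¹ := rfl

noncomputable instance : Group (Lamp R B) where
  mul_assoc x y z := Lamp.ext (by
    simp only [mul_fst, mul_snd, map_mul, mul_add, add_assoc, mul_assoc]) (mul_assoc _ _ _)
  one_mul x := Lamp.ext (by simp only [mul_fst, one_fst, one_snd, map_one, one_mul, zero_add])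
    (one_mul _)
  mul_one x := Lamp.ext (by simp only [mul_fst, one_fst, mul_zero, add_zero]) (mul_one _)
  inv_mul_cancel x := Lamp.ext (by
    simp only [mul_fst, inv_fst, inv_snd, one_fst, neg_add_cancel]) (inv_mul_cancel _)

/-- The projection to the acting group. -/
noncomputable def sndHom : Lamp R B →* B where
  toFun := snd
  map_one' := rfl
  map_mul' _ _ := rfl

/-- The embedding of the acting group. -/
noncomputable def inr : B →* Lamp R B where
  toFun b := ⟨0, b⟩
  map_one' := rfl
  map_mul' x y := Lamp.ext (by simp) rfl

@[simp] theorem inr_fst (b : B) : (inr b : Lamp R B).fst = 0 := rfl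
@[simp] theorem inr_snd (b : B) : (inr b : Lamp R B).snd = b := rfl

/-- The embedding of the base group. -/
noncomputable def inl : Multiplicative (MonoidAlgebra R B) →* Lamp R B where
  toFun f := ⟨f.toAdd, 1⟩
  map_one' := rfl
  map_mul' x y := Lamp.ext (by simp only [mul_fst, map_one, one_mul, toAdd_mul]) (one_mul _).symm

@[simp] theorem inl_fst (f : Multiplicative (MonoidAlgebra R B)) : (inl f).fst = f.toAdd := rfl
@[simp] theorem inl_snd (f : Multiplicative (MonoidAlgebra R B)) : (inl f).snd = 1 := rfl

/-- The equivalence with the product. -/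
noncomputable def equivProd : Lamp R B ≃ (B →₀ R) × B where
  toFun x := (x.fst.coeff, x.snd)
  invFun x := ⟨.ofCoeff x.1, x.2⟩
  left_inv _ := rfl
  right_inv _ := rfl

/-- The restricted wreath product is the semidirect product with the group ring. -/
noncomputable def wreathEquiv (R B : Type*) [CommRing R] [Group B] :
    restrictedWreathProduct (Multiplicative R) B ≃* Lamp R B where
  toFun x := ⟨.ofCoeff (Finsupp.ofSupportFinite (fun b ↦ (x.1.left b).toAdd) x.2), x.1.right⟩
  invFun x := ⟨⟨fun b ↦ .ofAdd (x.fst.coeff b), x.snd⟩, x.fst.coeff.hasFiniteSupport⟩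
  left_inv _ := rfl
  right_inv x := Lamp.ext (MonoidAlgebra.ext (Finsupp.ext fun _ ↦ rfl)) rfl
  map_mul' x y := Lamp.ext (MonoidAlgebra.ext (Finsupp.ext fun b ↦ by
    rw [mul_fst, MonoidAlgebra.coeff_add, Finsupp.add_apply, MonoidAlgebra.coeff_of_mul]; rfl)) rfl

end

-- Functoriality in the coefficients and in the group

section Map

variable {R S T : Type*} [CommRing R] [CommRing S] [CommRing T]
  {B C D : Type*} [Group B] [Group C] [Group D]

/-- The homomorphism of group rings induced by homomorphisms of rings and of groups. -/
noncomputable def ringMap (θ : R →+* S) (f : B →* C) : MonoidAlgebra R B →+* MonoidAlgebra S C :=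
  (MonoidAlgebra.mapRingHom C θ).comp (MonoidAlgebra.mapDomainRingHom R f)

@[simp] theorem ringMap_single (θ : R →+* S) (f : B →* C) (b : B) (r : R) :
    ringMap θ f (.single b r) = .single (f b) (θ r) := by
  simp [ringMap]

@[simp] theorem ringMap_of (θ : R →+* S) (f : B →* C) (b : B) :
    ringMap θ f (.of R B b) = .of S C (f b) := by
  simp [MonoidAlgebra.of_apply]

theorem ringMap_comp (θ : R →+* S) (f : B →* C) (θ' : S →+* T) (f' : C →* D) (x : MonoidAlgebra R B) :
    ringMap θ' f' (ringMap θ f x) = ringMap (θ'.comp θ) (f'.comp f) x := by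
  induction x using MonoidAlgebra.induction_linear with
  | zero => simp
  | add x y hx hy => simp only [map_add, hx, hy]
  | single b r => simp

theorem ringMap_surjective {θ : R →+* S} {f : B →* C} (hθ : Function.Surjective θ)
    (hf : Function.Surjective f) : Function.Surjective (ringMap θ f) := by
  intro x
  induction x using MonoidAlgebra.induction_linear with
  | zero => exact ⟨0, map_zero _⟩
  | add x y hx hy =>
    obtain ⟨x, rfl⟩ := hx
    obtain ⟨y, rfl⟩ := hy
    exact ⟨x + y, map_add _ _ _⟩
  | single c s =>
    obtain ⟨b, rfl⟩ := hf c
    obtain ⟨r, rfl⟩ := hθ s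
    exact ⟨_, ringMap_single _ _ _ _⟩

theorem coeff_ringMap (θ : R →+* S) (f : B →* C) (x : MonoidAlgebra R B) (c : C) :
    (ringMap θ f x).coeff c = θ ((MonoidAlgebra.mapDomain f x).coeff c) := by
  simp [ringMap]

theorem exists_of_coeff_ringMap_ne_zero {θ : R →+* S} {f : B →* C} {x : MonoidAlgebra R B} {c : C}
    (h : (ringMap θ f x).coeff c ≠ 0) : ∃ b, x.coeff b ≠ 0 ∧ f b = c := by
  classical
  rw [coeff_ringMap] at h
  have h1 : (Finsupp.mapDomain f x.coeff) c ≠ 0 := fun h0 ↦ h (by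
    rw [MonoidAlgebra.mapDomain, MonoidAlgebra.coeff_ofCoeff, h0, map_zero])
  obtain ⟨b, hb, e⟩ := Finset.mem_image.1 (Finsupp.mapDomain_support (Finsupp.mem_support_iff.2 h1))
  exact ⟨b, Finsupp.mem_support_iff.1 hb, e⟩

theorem coeff_ringMap_apply {θ : R →+* S} {f : B →* C} {x : MonoidAlgebra R B} {b : B}
    (h : ∀ b', x.coeff b' ≠ 0 → f b' = f b → b' = b) : (ringMap θ f x).coeff (f b) = θ (x.coeff b) := by
  classical
  have h1 : (ringMap θ f (x.erase b)).coeff (f b) = 0 := by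
    by_contra hne
    obtain ⟨b', hb', e⟩ := exists_of_coeff_ringMap_ne_zero hne
    rw [MonoidAlgebra.coeff_erase] at hb'
    by_cases hbb : b' = b
    · exact hb' (by rw [hbb, Finsupp.erase_same])
    · rw [Finsupp.erase_ne hbb] at hb'
      exact hbb (h b' hb' e)
  conv_lhs => rw [← MonoidAlgebra.single_add_erase b x, map_add, MonoidAlgebra.coeff_add,
    Finsupp.add_apply, h1, add_zero, ringMap_single, MonoidAlgebra.coeff_single, Finsupp.single_eq_same]

/-- The induced homomorphism of semidirect products. -/
noncomputable def map (θ : R →+* S) (f : B →* C) : Lamp R B →* Lamp S C where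
  toFun x := ⟨ringMap θ f x.fst, f x.snd⟩
  map_one' := Lamp.ext (map_zero _) (map_one _)
  map_mul' x y := Lamp.ext (by simp only [mul_fst, map_add, map_mul, ringMap_of]) (map_mul _ _ _)

theorem mem_ker_map {θ : R →+* S} {f : B →* C} {x : Lamp R B} :
    x ∈ (map θ f).ker ↔ ringMap θ f x.fst = 0 ∧ f x.snd = 1 := by
  rw [MonoidHom.mem_ker, Lamp.ext_iff]; rfl

theorem isPGroup {p : ℕ} [Fact p.Prime] {S C : Type*} [CommRing S] [Group C] [Finite C] {k : ℕ}
    (hS : Nat.card S = p ^ k) (hC : IsPGroup p C) : Finite (Lamp S C) ∧ IsPGroup p (Lamp S C) := by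
  classical
  have hS' : Finite S := Nat.finite_of_card_ne_zero (by
    rw [hS]; exact pow_ne_zero _ (Fact.out : p.Prime).ne_zero)
  cases nonempty_fintype C
  obtain ⟨l, hl⟩ := IsPGroup.iff_card.1 hC
  have : Finite (C →₀ S) := Finite.of_equiv _ Finsupp.equivFunOnFinite.symm
  refine ⟨Finite.of_equiv _ equivProd.symm, IsPGroup.of_card (n := k * p ^ l + l) ?_⟩
  rw [Nat.card_congr equivProd, Nat.card_prod, Nat.card_congr Finsupp.equivFunOnFinite, Nat.card_fun,
    hS, hl, pow_add, pow_mul]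

end Map

end Lamp

/-! ### Reduction modulo prime powers -/

section Reduction

/-- Reduction modulo `p ^ t` in each coordinate. -/
def modPow (p m t : ℕ) : (Fin m → ℤ) →+* (Fin m → ZMod (p ^ t)) :=
  RingHom.pi fun i ↦ (Int.castRingHom (ZMod (p ^ t))).comp (Pi.evalRingHom _ i)

variable {p m : ℕ}

theorem modPow_apply (t : ℕ) (v : Fin m → ℤ) (i : Fin m) : modPow p m t v i = (v i : ZMod (p ^ t)) :=
  rfl

theorem modPow_eq_zero_iff {t : ℕ} {v : Fin m → ℤ} :
    modPow p m t v = 0 ↔ ∀ i, ((p ^ t : ℕ) : ℤ) ∣ v i := by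
  simp only [funext_iff, modPow_apply, Pi.zero_apply, ZMod.intCast_zmod_eq_zero_iff_dvd]

theorem modPow_surjective (t : ℕ) : Function.Surjective (modPow p m t) := fun w ↦
  ⟨fun i ↦ (ZMod.intCast_surjective (w i)).choose, funext fun i ↦
    (ZMod.intCast_surjective (w i)).choose_spec⟩

theorem exists_modPow_ne_zero (hp : p.Prime) {v : Fin m → ℤ} (hv : v ≠ 0) : ∃ t, modPow p m t v ≠ 0 := by
  obtain ⟨i, hi⟩ := Function.ne_iff.1 hv
  -- The exponent t = |v i| suffices because t < p ^ t.
  refine ⟨(v i).natAbs, fun h ↦ ?_⟩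
  have h1 := Int.natAbs_dvd_natAbs.2 (modPow_eq_zero_iff.1 h i)
  rw [Int.natAbs_natCast] at h1
  exact (Nat.lt_pow_self hp.one_lt).not_ge (Nat.le_of_dvd (Int.natAbs_pos.2 hi) h1)

theorem exists_comp_modPow {s t : ℕ} (hst : s ≤ t) :
    ∃ θ : (Fin m → ZMod (p ^ t)) →+* (Fin m → ZMod (p ^ s)), θ.comp (modPow p m t) = modPow p m s := by
  refine ⟨RingHom.pi fun i ↦ (ZMod.castHom (pow_dvd_pow p hst) _).comp (Pi.evalRingHom _ i), ?_⟩
  refine RingHom.ext fun v ↦ funext fun i ↦ ?_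
  exact map_intCast (ZMod.castHom (pow_dvd_pow p hst) (ZMod (p ^ s))) (v i)

variable {B : Type*} [Group B]

open Lamp

/-- Reduction of the group ring modulo `p ^ t` and modulo a normal subgroup. -/
noncomputable def red (p m t : ℕ) (Δ : Subgroup B) [Δ.Normal] :
    MonoidAlgebra (Fin m → ℤ) B →+* MonoidAlgebra (Fin m → ZMod (p ^ t)) (B ⧸ Δ) :=
  ringMap (modPow p m t) (QuotientGroup.mk' Δ)

theorem red_surjective (t : ℕ) (Δ : Subgroup B) [Δ.Normal] : Function.Surjective (red p m t Δ) :=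
  ringMap_surjective (modPow_surjective t) (QuotientGroup.mk'_surjective Δ)

theorem red_of (t : ℕ) (Δ : Subgroup B) [Δ.Normal] (b : B) :
    red p m t Δ (.of _ B b) = .of _ (B ⧸ Δ) (b : B ⧸ Δ) :=
  ringMap_of _ _ _

theorem red_of_eq {t : ℕ} {Δ : Subgroup B} [Δ.Normal] {b c : B} (h : b⁻¹ * c ∈ Δ) :
    red p m t Δ (.of _ B b) = red p m t Δ (.of _ B c) := by
  rw [red_of, red_of, QuotientGroup.eq.2 h]

theorem red_eq_zero_of_le {s t : ℕ} (hst : s ≤ t) {Δ Δ' : Subgroup B} [Δ.Normal] [Δ'.Normal] (h : Δ' ≤ Δ)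
    {f : MonoidAlgebra (Fin m → ℤ) B} (hf : red p m t Δ' f = 0) : red p m s Δ f = 0 := by
  obtain ⟨θ, hθ⟩ := exists_comp_modPow (p := p) (m := m) hst
  have := ringMap_comp (modPow p m t) (QuotientGroup.mk' Δ') θ
    (QuotientGroup.map Δ' Δ (MonoidHom.id B) h) f
  rw [hθ] at this
  rw [red] at hf ⊢
  rw [hf, map_zero] at this
  exact this.symm

/-- The congruence subgroup of a wreath product. -/
noncomputable def congrSubgroup (p m t : ℕ) (Δ : Subgroup B) [Δ.Normal] : Subgroup (Lamp (Fin m → ℤ) B) :=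
  (Lamp.map (modPow p m t) (QuotientGroup.mk' Δ)).ker

theorem mem_congrSubgroup {t : ℕ} {Δ : Subgroup B} [Δ.Normal] {x : Lamp (Fin m → ℤ) B} :
    x ∈ congrSubgroup p m t Δ ↔ red p m t Δ x.fst = 0 ∧ x.snd ∈ Δ := by
  rw [congrSubgroup, mem_ker_map, QuotientGroup.mk'_apply, QuotientGroup.eq_one_iff]; rfl

theorem isCoP_congrSubgroup [Fact p.Prime] (t : ℕ) {Δ : Subgroup B} [Δ.Normal] (hΔ : IsCoP p Δ) :
    IsCoP p (congrSubgroup p m t Δ) := by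
  have := hΔ.finite
  obtain ⟨_, _, hp⟩ := hΔ
  obtain ⟨h1, h2⟩ := Lamp.isPGroup (p := p) (S := Fin m → ZMod (p ^ t)) (C := B ⧸ Δ) (k := t * m)
    (by rw [Nat.card_fun, Nat.card_zmod, Nat.card_fin, pow_mul]) hp
  have := h2.isCoP_bot.comap (Lamp.map (modPow p m t) (QuotientGroup.mk' Δ))
  rwa [MonoidHom.comap_bot] at this

/-- With p ^ t the index of `N`, the base part of `N` contains all multiples of p ^ t and, as
commutators, all f - ν f with ν in N ∩ B. Together these generate the kernel of the reduction. -/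
theorem exists_congrSubgroup_le [Fact p.Prime] {N : Subgroup (Lamp (Fin m → ℤ) B)} (hN : IsCoP p N) :
    ∃ (t : ℕ) (Δ : Subgroup B) (_ : Δ.Normal), IsCoP p Δ ∧ congrSubgroup p m t Δ ≤ N := by
  classical
  have hNn := hN.normal
  have hfin := hN.finite
  obtain ⟨t, ht⟩ := IsPGroup.iff_card.1 hN.2.2
  have hpow : ∀ y, y ^ p ^ t ∈ N := fun y ↦ by
    rw [← QuotientGroup.eq_one_iff, QuotientGroup.mk_pow, ← ht]
    exact pow_card_eq_one'
  let S : AddSubgroup (MonoidAlgebra (Fin m → ℤ) B) := Subgroup.toAddSubgroup' (N.comap Lamp.inl)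
  have hS : ∀ f, f ∈ S ↔ Lamp.inl (.ofAdd f) ∈ N := fun f ↦ Iff.rfl
  have hΔ : IsCoP p (N.comap Lamp.inr) := hN.comap _
  have hpS : ∀ f : MonoidAlgebra (Fin m → ℤ) B, p ^ t • f ∈ S := fun f ↦ by
    rw [hS, ofAdd_nsmul, map_pow]; exact hpow _
  have hcomm : ∀ ν ∈ N.comap (Lamp.inr (R := Fin m → ℤ)), ∀ f, f - .of _ B ν * f ∈ S := by
    intro ν hν f
    have h1 := hNn.conj_mem _ hν (Lamp.inl (.ofAdd f))
    have h2 := mul_mem h1 (inv_mem hν)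
    rw [hS]
    convert h2 using 1
    refine Lamp.ext ?_ ?_
    · simp only [inl_fst, inl_snd, toAdd_ofAdd, mul_fst, mul_snd, inr_fst, inr_snd, inv_fst, inv_snd,
        inv_one, map_one, one_mul, mul_zero, add_zero, neg_zero, mul_neg, sub_eq_add_neg]
    · simp only [inl_snd, mul_snd, inr_snd, inv_snd]; group
  refine ⟨t, N.comap Lamp.inr, hΔ.normal, hΔ, fun x hx ↦ ?_⟩
  set Δ := N.comap (Lamp.inr (R := Fin m → ℤ))
  have hΔn := hΔ.normal
  rw [mem_congrSubgroup] at hx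
  have hx1 : x.fst ∈ S := by
    -- Moving the support of `x.fst` onto coset representatives changes it by an element of `S`; the
    -- collected coefficients are then divisible by p ^ t.
    let σ : B ⧸ Δ → B := Quotient.out
    have hσ : ∀ b : B, ∃ ν ∈ Δ, σ b = ν * b := fun b ↦ by
      refine ⟨σ b * b⁻¹, ?_, by group⟩
      have := hΔn.conj_mem _ (QuotientGroup.eq.1 (QuotientGroup.out_eq' (b : B ⧸ Δ)).symm) b
      simpa [σ] using this
    have h1 : ∀ f : MonoidAlgebra (Fin m → ℤ) B,
        f - MonoidAlgebra.mapDomain (fun b : B ↦ σ b) f ∈ S := by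
      intro f
      induction f using MonoidAlgebra.induction_linear with
      | zero => simp [zero_mem]
      | add f g hf hg =>
        rw [MonoidAlgebra.mapDomain_add, add_sub_add_comm]; exact add_mem hf hg
      | single b r =>
        obtain ⟨ν, hν, e⟩ := hσ b
        have := hcomm ν hν (.single b r)
        rw [MonoidAlgebra.mapDomain_single]
        rwa [MonoidAlgebra.of_apply, MonoidAlgebra.single_mul_single, one_mul, ← e] at this
    have h2 : MonoidAlgebra.mapDomain (fun b : B ↦ σ b) x.fst ∈ S := by
      have e0 : MonoidAlgebra.mapDomain (fun b : B ↦ σ b) x.fst =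
          MonoidAlgebra.mapDomain σ (MonoidAlgebra.mapDomain (QuotientGroup.mk' Δ) x.fst) := by
        refine MonoidAlgebra.ext ?_
        simp only [MonoidAlgebra.mapDomain, MonoidAlgebra.coeff_ofCoeff]
        rw [← Finsupp.mapDomain_comp]; rfl
      have hdvd : ∀ q i, ((p ^ t : ℕ) : ℤ) ∣ (MonoidAlgebra.mapDomain (QuotientGroup.mk' Δ) x.fst).coeff q i :=
        fun q ↦ modPow_eq_zero_iff.1 (by
          have := coeff_ringMap (modPow p m t) (QuotientGroup.mk' Δ) x.fst q
          rw [← this, show ringMap (modPow p m t) (QuotientGroup.mk' Δ) x.fst = 0 from hx.1]; rfl)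
      rw [e0]
      set y := MonoidAlgebra.mapDomain (QuotientGroup.mk' Δ) x.fst
      have e1 : y = p ^ t • MonoidAlgebra.ofCoeff (y.coeff.mapRange (fun v i ↦ v i / ((p ^ t : ℕ) : ℤ))
          (by ext; simp)) := by
        refine MonoidAlgebra.ext (Finsupp.ext fun q ↦ funext fun i ↦ ?_)
        have := Int.mul_ediv_cancel' (hdvd q i)
        rw [MonoidAlgebra.coeff_smul, Finsupp.smul_apply, Pi.smul_apply, nsmul_eq_mul]
        exact this.symm
      rw [e1]
      have e2 : ∀ (n : ℕ) (z : MonoidAlgebra (Fin m → ℤ) (B ⧸ Δ)),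
          MonoidAlgebra.mapDomain σ (n • z) = n • MonoidAlgebra.mapDomain σ z := by
        intro n z
        induction n with
        | zero => simp
        | succ n ih => rw [succ_nsmul, succ_nsmul, MonoidAlgebra.mapDomain_add, ih]
      rw [e2]
      exact hpS _
    simpa using add_mem (h1 x.fst) h2
  have hx2 : Lamp.inr x.snd ∈ N := hx.2
  have := mul_mem ((hS _).1 hx1) hx2
  convert this using 1
  refine Lamp.ext ?_ ?_
  · simp only [inl_fst, mul_fst, inr_fst, toAdd_ofAdd, mul_zero, add_zero]
  · simp only [inl_snd, mul_snd, inr_snd, one_mul]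

end Reduction

-- Closed conjugation orbits in the wreath product

section WreathProduct

open Lamp

variable {p m : ℕ} {B : Type*} [Group B]

theorem exists_isCoP_forall_mem (res : ∀ b : B, b ≠ 1 → ∃ Δ : Subgroup B, IsCoP p Δ ∧ b ∉ Δ) (F : Finset B) :
    ∃ Δ : Subgroup B, IsCoP p Δ ∧ ∀ b ∈ F, b ∈ Δ → b = 1 := by
  have : ∀ b : F, ∃ Δ : Subgroup B, IsCoP p Δ ∧ (b.1 ∈ Δ → b.1 = 1) := by
    intro b
    by_cases hb : b.1 = 1
    · exact ⟨⊤, isCoP_top, fun _ ↦ hb⟩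
    · obtain ⟨Δ, h1, h2⟩ := res b hb
      exact ⟨Δ, h1, fun h ↦ (h2 h).elim⟩
  choose Δ h1 h2 using this
  exact ⟨⨅ b, Δ b, IsCoP.iInf h1, fun b hb h ↦ h2 ⟨b, hb⟩ (Subgroup.mem_iInf.1 h ⟨b, hb⟩)⟩

theorem modPow_ne_zero_of_le {s t : ℕ} (hst : s ≤ t) {v : Fin m → ℤ} (hv : modPow p m s v ≠ 0) :
    modPow p m t v ≠ 0 := by
  obtain ⟨θ, hθ⟩ := exists_comp_modPow (p := p) (m := m) hst
  intro h
  rw [← hθ, RingHom.comp_apply, h, map_zero] at hv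
  exact hv rfl

theorem coeff_red_ne_zero {t : ℕ} {Δ : Subgroup B} [Δ.Normal] {f : MonoidAlgebra (Fin m → ℤ) B} {y : B}
    (hΔ : ∀ b, f.coeff b ≠ 0 → b⁻¹ * y ∈ Δ → b = y) (ht : modPow p m t (f.coeff y) ≠ 0) :
    (red p m t Δ f).coeff (y : B ⧸ Δ) ≠ 0 := by
  have := coeff_ringMap_apply (θ := modPow p m t) (f := QuotientGroup.mk' Δ) (x := f) (b := y)
    fun b hb e ↦ hΔ b hb (QuotientGroup.eq.1 e)
  exact fun h ↦ ht (this.symm.trans h)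

theorem exists_separating [hp : Fact p.Prime]
    (res : ∀ b : B, b ≠ 1 → ∃ Δ : Subgroup B, IsCoP p Δ ∧ b ∉ Δ)
    {f : MonoidAlgebra (Fin m → ℤ) B} {y : B} (hy : f.coeff y ≠ 0) :
    ∃ (t : ℕ) (Δ : Subgroup B), IsCoP p Δ ∧ (∀ b, f.coeff b ≠ 0 → b⁻¹ * y ∈ Δ → b = y) ∧
      modPow p m t (f.coeff y) ≠ 0 := by
  classical
  obtain ⟨t, ht⟩ := exists_modPow_ne_zero hp.out hy
  obtain ⟨Δ, h1, h2⟩ := exists_isCoP_forall_mem res (f.coeff.support.image fun b ↦ b⁻¹ * y)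
  exact ⟨t, Δ, h1, fun b hb hb' ↦ inv_mul_eq_one.1 (h2 _ (Finset.mem_image_of_mem _
    (Finsupp.mem_support_iff.2 hb)) hb'), ht⟩

theorem eq_zero_of_red_eq_zero [Fact p.Prime]
    (res : ∀ b : B, b ≠ 1 → ∃ Δ : Subgroup B, IsCoP p Δ ∧ b ∉ Δ) {f : MonoidAlgebra (Fin m → ℤ) B}
    (h : ∀ (t : ℕ) (Δ : Subgroup B) [Δ.Normal], IsCoP p Δ → red p m t Δ f = 0) : f = 0 := by
  by_contra hf
  obtain ⟨y, hy⟩ : ∃ y, f.coeff y ≠ 0 := by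
    by_contra! hc
    exact hf (MonoidAlgebra.ext (Finsupp.ext hc))
  obtain ⟨t, Δ, hΔ, h1, h2⟩ := exists_separating res hy
  have := hΔ.normal
  exact coeff_red_ne_zero h1 h2 (by rw [h t Δ hΔ]; rfl)

theorem red_traceElt {t : ℕ} {Δ : Subgroup B} [Δ.Normal] {γ : B} (hγ : IsOfFinOrder γ)
    (h : ∀ i < orderOf γ, γ ^ i ∈ Δ → γ ^ i = 1) :
    red p m t Δ (traceElt _ γ) = traceElt _ (γ : B ⧸ Δ) := by
  have ho : orderOf (γ : B ⧸ Δ) = orderOf γ := by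
    refine (orderOf_eq_iff hγ.orderOf_pos).2 ⟨?_, fun i hi h0 e ↦ ?_⟩
    · rw [← QuotientGroup.mk_pow, pow_orderOf_eq_one]; rfl
    · rw [← QuotientGroup.mk_pow, QuotientGroup.eq_one_iff] at e
      exact ((orderOf_eq_iff hγ.orderOf_pos).1 rfl).2 i hi h0 (h i hi e)
  simp only [traceElt, map_sum, map_pow, red_of, ho]

/-- The image of a congruence subgroup of the group ring under `1 - γ` is closed. -/
theorem exists_eq_one_sub_mul_of_red [Fact p.Prime]
    (res : ∀ b : B, b ≠ 1 → ∃ Δ : Subgroup B, IsCoP p Δ ∧ b ∉ Δ)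
    {s : ℕ} {Δ : Subgroup B} [Δ.Normal] (hΔ : IsCoP p Δ) {γ : B} (hγ : IsOfFinOrder γ)
    {f : MonoidAlgebra (Fin m → ℤ) B}
    (H : ∀ (t : ℕ) (E : Subgroup B) [E.Normal], IsCoP p E →
      ∃ h, red p m s Δ h = 0 ∧ red p m t E f = red p m t E ((1 - .of _ B γ) * h)) :
    ∃ h, red p m s Δ h = 0 ∧ f = (1 - .of _ B γ) * h := by
  classical
  obtain ⟨ψ, rfl⟩ : ∃ ψ, f = (1 - .of _ B γ) * ψ := by
    refine exists_eq_one_sub_mul hγ (eq_zero_of_red_eq_zero res fun t E _ hE ↦ ?_)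
    obtain ⟨h, -, e⟩ := H t E hE
    rw [map_mul, e, ← map_mul, ← mul_assoc, traceElt_mul_one_sub, zero_mul, map_zero]
  -- `E₀` meets `⟨γ⟩` trivially, so `γ` keeps its order in the quotient and the trace reduces to the
  -- trace.
  obtain ⟨E₀, hE₀, hE₀'⟩ := exists_isCoP_forall_mem res ((Finset.range (orderOf γ)).image (γ ^ ·))
  have hE := hE₀.inf hΔ
  have hEn := hE.normal
  obtain ⟨h, h1, h2⟩ := H s (E₀ ⊓ Δ) hE
  have h3 : (1 - MonoidAlgebra.of _ (B ⧸ (E₀ ⊓ Δ)) (γ : B ⧸ (E₀ ⊓ Δ))) * red p m s (E₀ ⊓ Δ) (ψ - h) = 0 := by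
    rw [← red_of, ← map_one (red p m s (E₀ ⊓ Δ)), ← map_sub, ← map_mul, mul_sub, map_sub, h2, sub_self]
  have hγ' : IsOfFinOrder (γ : B ⧸ (E₀ ⊓ Δ)) := (QuotientGroup.mk' (E₀ ⊓ Δ)).isOfFinOrder hγ
  obtain ⟨e, he⟩ := exists_eq_traceElt_mul hγ' h3
  obtain ⟨e, rfl⟩ := red_surjective (p := p) s (E₀ ⊓ Δ) e
  have hE' : ∀ i < orderOf γ, γ ^ i ∈ E₀ ⊓ Δ → γ ^ i = 1 := fun i hi hi' ↦
    hE₀' _ (Finset.mem_image_of_mem _ (Finset.mem_range.2 hi)) hi'.1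
  rw [← red_traceElt hγ hE', ← map_mul, ← sub_eq_zero, ← map_sub] at he
  have h4 := red_eq_zero_of_le le_rfl inf_le_right he
  -- Subtracting a multiple of the trace does not change the product with 1 - γ, and it makes the
  -- factor congruent to `h`, hence to zero, modulo (s, Δ).
  refine ⟨ψ - traceElt _ γ * e, ?_, ?_⟩
  · rw [sub_right_comm, map_sub, h1, sub_zero] at h4
    exact h4
  · rw [mul_sub, ← mul_assoc, one_sub_mul_traceElt, zero_mul, sub_zero]

/-- Turns the approximate centralisers ν into one exact centraliser. Applying the trace removes `h`
and leaves ν T f ≡ T f'. A support point y of T f ≠ 0 must then go to one of T f', so ν is congruent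
to an element of a finite set independent of the level. -/
theorem exists_commuting [Fact p.Prime]
    (res : ∀ b : B, b ≠ 1 → ∃ Δ : Subgroup B, IsCoP p Δ ∧ b ∉ Δ)
    {s : ℕ} {Δ : Subgroup B} [Δ.Normal] (hΔ : IsCoP p Δ) {γ : B} (hγ : IsOfFinOrder γ)
    {f f' : MonoidAlgebra (Fin m → ℤ) B}
    (H : ∀ (t : ℕ) (E : Subgroup B) [E.Normal], IsCoP p E → ∃ h, ∃ ν ∈ Δ, red p m s Δ h = 0 ∧
      (ν * γ)⁻¹ * (γ * ν) ∈ E ∧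
      red p m t E (h + .of _ B ν * f) = red p m t E (f' + .of _ B γ * h)) :
    ∃ z ∈ Δ, z * γ = γ * z ∧ ∀ (t : ℕ) (E : Subgroup B) [E.Normal], IsCoP p E →
      ∃ h, red p m s Δ h = 0 ∧
        red p m t E (f' - .of _ B z * f) = red p m t E ((1 - .of _ B γ) * h) := by
  classical
  by_cases hF : traceElt _ γ * f = 0
  · obtain ⟨e, rfl⟩ := exists_eq_one_sub_mul hγ hF
    refine ⟨1, one_mem _, by simp, fun t E _ hE ↦ ?_⟩
    obtain ⟨h, ν, hν, h1, h2, h3⟩ := H t E hE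
    -- With f = (1 - γ) e, replacing ν by 1 is compensated by ν e - e, which reduces to zero modulo
    -- Δ because ν ∈ Δ.
    refine ⟨h + .of _ B ν * e - e, ?_, ?_⟩
    · have : red p m s Δ (.of _ B ν) = 1 := by
        rw [red_of, (QuotientGroup.eq_one_iff ν).2 hν, map_one]
      rw [map_sub, map_add, map_mul, this, one_mul, h1, zero_add, sub_self]
    · have hcomm := red_of_eq (p := p) (m := m) (t := t) h2
      simp only [map_mul, map_add, map_sub, map_one] at hcomm h3 ⊢
      have h4 : red p m t E f' = red p m t E h +
          red p m t E (.of _ B ν) * ((1 - red p m t E (.of _ B γ)) * red p m t E e) -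
          red p m t E (.of _ B γ) * red p m t E h := by
        rw [h3, add_sub_cancel_right]
      have h5 : red p m t E (.of _ B ν) * ((1 - red p m t E (.of _ B γ)) * red p m t E e) =
          (1 - red p m t E (.of _ B γ)) * (red p m t E (.of _ B ν) * red p m t E e) := by
        rw [← mul_assoc, ← mul_assoc, mul_sub, sub_mul (1 : MonoidAlgebra _ _), hcomm, mul_one, one_mul]
      rw [h4, h5]
      simp only [sub_mul, mul_sub, mul_add, one_mul]
      abel
  · obtain ⟨y, hy⟩ : ∃ y, (traceElt _ γ * f).coeff y ≠ 0 := by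
      by_contra! hc
      exact hF (MonoidAlgebra.ext (Finsupp.ext hc))
    obtain ⟨t₀, E₀, hE₀, sep, sep'⟩ := exists_separating res hy
    set F := traceElt _ γ * f
    set F' := traceElt _ γ * f'
    let Z := F'.coeff.support.image (· * y⁻¹)
    have key : ∃ z ∈ Z, ∀ (t : ℕ) (E : Subgroup B) [E.Normal], IsCoP p E → ∃ h, ∃ ν ∈ Δ,
        red p m s Δ h = 0 ∧ (ν * γ)⁻¹ * (γ * ν) ∈ E ∧ ν⁻¹ * z ∈ E ∧
        red p m t E (h + .of _ B ν * f) = red p m t E (f' + .of _ B γ * h) := by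
      by_contra hcon
      have hcon' : ∀ z : Z, ∃ (t : ℕ) (E : Subgroup B) (_ : E.Normal), IsCoP p E ∧ ¬ ∃ h, ∃ ν ∈ Δ,
          red p m s Δ h = 0 ∧ (ν * γ)⁻¹ * (γ * ν) ∈ E ∧ ν⁻¹ * z.1 ∈ E ∧
          red p m t E (h + .of _ B ν * f) = red p m t E (f' + .of _ B γ * h) := by
        intro z
        by_contra hz
        refine hcon ⟨z, z.2, fun t E hn hE ↦ ?_⟩
        by_contra hc
        exact hz ⟨t, E, hn, hE, hc⟩
      -- If every candidate fails at some level, all fail at a common finer level, where the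
      -- hypothesis still supplies some ν.
      choose t E hn hE hnot using hcon'
      have hE₁ := hE₀.inf (IsCoP.iInf hE)
      have := hE₁.normal
      set E₁ := E₀ ⊓ ⨅ z, E z
      set t₁ := max t₀ (Finset.univ.sup t)
      obtain ⟨h, ν, hν, h1, h2, h3⟩ := H t₁ E₁ hE₁
      have hcomm := red_of_eq (p := p) (m := m) (t := t₁) h2
      have hTr : red p m t₁ E₁ (.of _ B ν) * red p m t₁ E₁ (traceElt _ γ) =
          red p m t₁ E₁ (traceElt _ γ) * red p m t₁ E₁ (.of _ B ν) := by
        have : Commute (red p m t₁ E₁ (.of _ B ν)) (red p m t₁ E₁ (.of _ B γ)) := by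
          rw [Commute, SemiconjBy, ← map_mul, ← map_mul, ← map_mul, ← map_mul, hcomm]
        simp only [traceElt, map_sum, map_pow]
        exact Commute.sum_right _ _ _ fun i _ ↦ this.pow_right i
      have h4 : red p m t₁ E₁ (.of _ B ν * F) = red p m t₁ E₁ F' := by
        have := congrArg (red p m t₁ E₁ (traceElt _ γ) * ·) h3
        simp only [← map_mul, mul_add] at this
        have h0 : traceElt _ γ * (.of _ B γ * h) = traceElt _ γ * h := by
          have := congrArg (· * h) (traceElt_mul_one_sub (R := Fin m → ℤ) γ)
          simp only [mul_sub, sub_mul, mul_one, zero_mul, mul_assoc] at this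
          exact (sub_eq_zero.1 this).symm
        rw [h0, add_comm, map_add, map_add, add_left_inj] at this
        rw [← this, map_mul, map_mul, map_mul, map_mul, ← mul_assoc, hTr, mul_assoc]
      -- `E₀` separates `y` from the rest of the support, so its coefficient survives reduction
      -- without cancellation.
      have h5 : (red p m t₁ E₁ (.of _ B ν * F)).coeff ((ν * y : B) : B ⧸ E₁) ≠ 0 := by
        refine coeff_red_ne_zero (fun b hb hb' ↦ ?_) ?_
        · rw [MonoidAlgebra.coeff_of_mul] at hb
          have := sep _ hb (by simpa [mul_assoc] using hb'.1)
          rw [← this]; group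
        · rw [MonoidAlgebra.coeff_of_mul, inv_mul_cancel_left]
          exact modPow_ne_zero_of_le (le_max_left _ _) sep'
      rw [h4] at h5
      obtain ⟨y', hy', e⟩ := exists_of_coeff_ringMap_ne_zero h5
      have e : ν⁻¹ * (y' * y⁻¹) ∈ E₁ := by
        have := hE₁.normal.conj_mem _ (inv_mem (QuotientGroup.eq.1 e)) y
        convert this using 1
        group
      have hz : y' * y⁻¹ ∈ Z := Finset.mem_image_of_mem _ (Finsupp.mem_support_iff.2 hy')
      have hle : E₁ ≤ E ⟨_, hz⟩ := inf_le_right.trans (iInf_le _ _)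
      refine hnot ⟨_, hz⟩ ⟨h, ν, hν, h1, hle h2, hle e, ?_⟩
      rw [← sub_eq_zero, ← map_sub] at h3 ⊢
      exact red_eq_zero_of_le ((Finset.le_sup (Finset.mem_univ _)).trans (le_max_right _ _)) hle h3
    obtain ⟨z, -, hz⟩ := key
    refine ⟨z, ?_, ?_, fun t E _ hE ↦ ?_⟩
    · obtain ⟨h, ν, hν, -, -, h3, -⟩ := hz 0 Δ hΔ
      simpa using mul_mem hν h3
    · by_contra hne
      obtain ⟨E, hE, hE'⟩ := res ((z * γ)⁻¹ * (γ * z)) fun h ↦ hne (inv_mul_eq_one.1 h)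
      have := hE.normal
      obtain ⟨h, ν, hν, -, h2, h3, -⟩ := hz 0 E hE
      refine hE' ?_
      rw [← QuotientGroup.eq] at h2 h3 ⊢
      simp only [QuotientGroup.mk_mul] at h2 ⊢
      rwa [← h3]
    · obtain ⟨h, ν, hν, h1, -, h3, h4⟩ := hz t E hE
      refine ⟨h, h1, ?_⟩
      have := red_of_eq (p := p) (m := m) (t := t) h3
      simp only [map_mul, map_add, map_sub, map_one, this] at h4 ⊢
      rw [sub_mul, one_mul, sub_eq_sub_iff_add_eq_add, ← h4]

/-- Closed orbits in `B` give a conjugator that makes the `B`-components equal. Only congruence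
subgroups need treatment, since they lie below every co-`p` subgroup, and for these the equation in
the group ring is solved exactly. -/
theorem Lamp.hasClosedConjOrbits [Fact p.Prime] (hB : HasClosedConjOrbits p B)
    (tors : ∀ b : B, IsOfFinOrder b) (res : ∀ b : B, b ≠ 1 → ∃ Δ : Subgroup B, IsCoP p Δ ∧ b ∉ Δ) :
    HasClosedConjOrbits p (Lamp (Fin m → ℤ) B) := by
  refine .of_basis fun N hN ↦ ?_
  obtain ⟨s, Δ, _, hΔ, hle⟩ := exists_congrSubgroup_le hN
  have hco := isCoP_congrSubgroup (m := m) s hΔ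
  refine ⟨congrSubgroup p m s Δ, hle, hco, ?_⟩
  have key : ∀ g x : Lamp (Fin m → ℤ) B, g.snd = x.snd →
      (∀ L, IsCoP p L → ∃ n ∈ congrSubgroup p m s Δ, n * g * n⁻¹ * x⁻¹ ∈ L) →
      ∃ n ∈ congrSubgroup p m s Δ, n * g * n⁻¹ = x := by
    rintro ⟨f, γ⟩ ⟨f', γ'⟩ (rfl : γ = γ') H
    obtain ⟨z, hz, hzγ, hz'⟩ := exists_commuting (m := m) (f := f) (f' := f') (s := s) res hΔ (tors γ)
      fun t E _ hE ↦ by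
        obtain ⟨n, hn, hn'⟩ := H _ (isCoP_congrSubgroup t hE)
        rw [mem_congrSubgroup] at hn
        have e : Lamp.map (modPow p m t) (QuotientGroup.mk' E) (n * ⟨f, γ⟩) =
            Lamp.map (modPow p m t) (QuotientGroup.mk' E) (⟨f', γ⟩ * n) := by
          have : Lamp.map (modPow p m t) (QuotientGroup.mk' E) (n * ⟨f, γ⟩ * n⁻¹ * ⟨f', γ⟩⁻¹) = 1 := hn'
          rw [map_mul, map_inv, mul_inv_eq_one, map_mul, map_inv, mul_inv_eq_iff_eq_mul,
            ← map_mul _ _ n] at this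
          exact this
        exact ⟨n.fst, n.snd, hn.2, hn.1, QuotientGroup.eq.1 (congrArg Lamp.snd e),
          congrArg Lamp.fst e⟩
    obtain ⟨h, h1, h2⟩ := exists_eq_one_sub_mul_of_red res hΔ (tors γ) hz'
    refine ⟨⟨h, z⟩, mem_congrSubgroup.2 ⟨h1, hz⟩, ?_⟩
    rw [mul_inv_eq_iff_eq_mul]
    refine Lamp.ext ?_ hzγ
    rw [sub_mul, one_mul, sub_eq_sub_iff_add_eq_add] at h2
    exact h2.symm
  intro g x H
  obtain ⟨ν, hν, e⟩ := hB Δ hΔ g.snd x.snd fun L hL ↦ by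
    obtain ⟨n, hn, hn'⟩ := H _ (hL.comap Lamp.sndHom)
    exact ⟨n.snd, (mem_congrSubgroup.1 hn).2, hn'⟩
  have hν' : Lamp.inr ν ∈ congrSubgroup p m s Δ := mem_congrSubgroup.2 ⟨map_zero _, hν⟩
  obtain ⟨n, hn, hn'⟩ := key (Lamp.inr ν * g * (Lamp.inr ν)⁻¹) x e fun L hL ↦ by
    obtain ⟨n, hn, hn'⟩ := H L hL
    refine ⟨n * (Lamp.inr ν)⁻¹, mul_mem hn (inv_mem hν'), ?_⟩
    convert hn' using 1
    group
  refine ⟨n * Lamp.inr ν, mul_mem hn hν', ?_⟩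
  rw [← hn']
  group

end WreathProduct

theorem mainTheorem6 (m : ℕ) :
    IsPHereditarilyConjSeparable 2
      (restrictedWreathProduct (Multiplicative (Fin m → ℤ)) grigorchukGroup) := by
  refine HasClosedConjOrbits.isPHereditarilyConjSeparable (.of_mulEquiv (Lamp.wreathEquiv _ _)
    (Lamp.hasClosedConjOrbits Grigorchuk.hasClosedConjOrbits Grigorchuk.isOfFinOrder_grig fun g hg ↦ ?_))
  by_contra! hc
  exact hg (Grigorchuk.eq_one_of_mem_St fun n ↦ hc _ (Grigorchuk.isCoP_St n))
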